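/- Let $n=n_x$, $m=n_u$, let $f:\mathbb R^{n}\times\mathbb R^{m}\to\mathbb R^{n}$ and $l:\mathbb R^{n}\times\mathbb R^{m}\to\mathbb R$ be twice continuously differentiable, with $f$ globally Lipschitz continuous in $x$. Put $H(x,u,\lambda)=\lambda^{\top}f(x,u)+l(x,u)$ and let $u^\star(x,\lambda)$ be a minimizer of $u\mapsto H(x,u,\lambda)$ that depends continuously on $(x,\lambda)$ and satisfies the second order condition $H_{uu}(x,u^\star(x,\lambda),\lambda)\succ0$ for all $(x,\lambda)$. Let $F:\mathbb R^{2n}\to\mathbb R^{2n}$, $$F(x,\lambda)=\begin{pmatrix} f(x,u^\star(x,\lambda))\\ -\nabla_xH(x,u^\star(x,\lambda),\lambda)\end{pmatrix},$$ be the right-hand side of Pontryagin's differential equation. Let $W_{k,2}$ be the Sobolev space of complex-valued functions on $\mathbb R^{2n}$ whose weak derivatives up to order $k$ (including order $0$) are in $L_2$; put $$\omega(\varphi,\Phi)=\int_{\mathbb R^{2n}}\nabla\varphi(z)^{\top}\,\Omega\,\nabla\Phi(z)\,\mathrm dz,\qquad \Omega=\begin{pmatrix}0&I\\-I&0\end{pmatrix}$$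 (no complex conjugation), and let $L\Phi=F^{\top}\nabla\Phi$ be the Koopman generator. Then $L$ admits the symplectic adjoint $L^\star=-L$ on $W_{2,2}$, in the following sense. 1. As an operator in $W_{1,2}$ with its natural domain $D(L)=\{\Phi\in W_{2,2}: L\Phi\in W_{1,2}\}$, $L$ has $-L$ as a symplectic adjoint: $\omega(\varphi,L\Phi)=\omega(-L\varphi,\Phi)$ for all $\varphi,\Phi\in D(L)$. 2. $D(L)$ contains every $\Phi\in W_{2,2}$ with compact support. 3. For every $\Phi\in W_{2,2}$ the function $L\Phi$ is locally integrable and has locally integrable weak first derivatives. 4. If Pontryagin's differential equation $\dot y=F(y)$ has a flow $\Gamma_t:\mathbb R^{2n}\to\mathbb R^{2n}$ defined for all $t\in\mathbb R$, then $\omega(\varphi,L\Phi)=\omega(-L\varphi,\Phi)$ for all $\varphi,\Phi\in W_{2,2}$ for which the integrals defining the two sides converge absolutely. -/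

import Mathlib

open MeasureTheory
open scoped ENNReal ContDiff Matrix

noncomputable section

namespace PontryaginKoopman

/-! ### The optimal control problem and Pontryagin's vector field -/

/-- The phase space `ℝ^{2n}`; the coordinates `Sum.inl i` are those of the state `x`, the
coordinates `Sum.inr i` are those of the co-state `lam`. -/
abbrev Phase (n : ℕ) : Type := EuclideanSpace ℝ (Fin n ⊕ Fin n)

/-- The state component `x` of `y = (x, lam)`. -/
def statePart {n : ℕ} (y : Phase n) : EuclideanSpace ℝ (Fin n) :=
  WithLp.toLp 2 fun i => y (Sum.inl i)

/-- The co-state component `lam` of `y = (x, lam)`. -/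
def costatePart {n : ℕ} (y : Phase n) : EuclideanSpace ℝ (Fin n) :=
  WithLp.toLp 2 fun i => y (Sum.inr i)

/-- The stacked vector `(x, lam)`. -/
def stack {n : ℕ} (x lam : EuclideanSpace ℝ (Fin n)) : Phase n :=
  WithLp.toLp 2 (Sum.elim (fun i => x i) (fun i => lam i))

/-- The Hamiltonian `H(x, u, lam) = lamᵀ f(x, u) + l(x, u)`. -/
def hamiltonian {n m : ℕ}
    (f : EuclideanSpace ℝ (Fin n) → EuclideanSpace ℝ (Fin m) → EuclideanSpace ℝ (Fin n))
    (l : EuclideanSpace ℝ (Fin n) → EuclideanSpace ℝ (Fin m) → ℝ)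
    (x : EuclideanSpace ℝ (Fin n)) (u : EuclideanSpace ℝ (Fin m))
    (lam : EuclideanSpace ℝ (Fin n)) : ℝ :=
  inner ℝ lam (f x u) + l x u

/-- The right-hand side `F(x, lam) = (f(x, u⋆(x, lam)), -∇ₓ H(x, u⋆(x, lam), lam))` of Pontryagin's
differential equation; the gradient is the partial one, with `u` held fixed. -/
def pontryaginField {n m : ℕ}
    (f : EuclideanSpace ℝ (Fin n) → EuclideanSpace ℝ (Fin m) → EuclideanSpace ℝ (Fin n))
    (l : EuclideanSpace ℝ (Fin n) → EuclideanSpace ℝ (Fin m) → ℝ)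
    (ustar : EuclideanSpace ℝ (Fin n) → EuclideanSpace ℝ (Fin n) → EuclideanSpace ℝ (Fin m))
    (y : Phase n) : Phase n :=
  stack (f (statePart y) (ustar (statePart y) (costatePart y)))
    (-gradient
      (fun x => hamiltonian f l x (ustar (statePart y) (costatePart y)) (costatePart y))
      (statePart y))

/-- `Γ` is the (global) flow of the vector field `F`. -/
def IsFlow {n : ℕ} (F : Phase n → Phase n) (Γ : ℝ → Phase n → Phase n) : Prop :=
  ∀ z, Γ 0 z = z ∧ ∀ t, HasDerivAt (fun s => Γ s z) (F (Γ t z)) t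

/-! ### Weak derivatives and Sobolev spaces of complex-valued functions on `ℝ^{2n}` -/

/-- Measurable functions `ℝ^{2n} → ℂ` modulo equality almost everywhere. -/
abbrev Obs (n : ℕ) : Type := Phase n →ₘ[(volume : Measure (Phase n))] ℂ

/-- `g` is the weak partial derivative of `Φ` in the `i`-th coordinate direction. -/
def HasWeakDeriv {n : ℕ} (i : Fin n ⊕ Fin n) (Φ g : Obs n) : Prop :=
  LocallyIntegrable (fun z => Φ z) (volume : Measure (Phase n)) ∧
  LocallyIntegrable (fun z => g z) (volume : Measure (Phase n)) ∧
  ∀ ψ : Phase n → ℝ, ContDiff ℝ ∞ ψ → HasCompactSupport ψ →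
    ∫ z, (fderiv ℝ ψ z (EuclideanSpace.single i 1)) • Φ z = -∫ z, ψ z • g z

theorem HasWeakDeriv.unique {n : ℕ} {i : Fin n ⊕ Fin n} {Φ g g' : Obs n}
    (h : HasWeakDeriv i Φ g) (h' : HasWeakDeriv i Φ g') : g = g' := by
  refine AEEqFun.ext ?_
  refine ae_eq_of_integral_contDiff_smul_eq h.2.1 h'.2.1 ?_
  intro ψ hψ hc
  have e := (h.2.2 ψ hψ hc).symm.trans (h'.2.2 ψ hψ hc)
  exact neg_injective e

theorem integrable_test_smul {n : ℕ} {g : Phase n → ℂ} (hg : LocallyIntegrable g volume)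
    {ψ : Phase n → ℝ} (hψ : Continuous ψ) (hc : HasCompactSupport ψ) :
    Integrable (fun z => ψ z • g z) volume :=
  hg.integrable_smul_left_of_hasCompactSupport hψ hc

theorem integrable_test_fderiv_smul {n : ℕ} {g : Phase n → ℂ} (hg : LocallyIntegrable g volume)
    {ψ : Phase n → ℝ} (hψ : ContDiff ℝ ∞ ψ) (hc : HasCompactSupport ψ) (v : Phase n) :
    Integrable (fun z => (fderiv ℝ ψ z v) • g z) volume :=
  integrable_test_smul hg ((hψ.continuous_fderiv (by simp)).clm_apply continuous_const)
    (hc.fderiv_apply ℝ v)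

theorem HasWeakDeriv.add {n : ℕ} {i : Fin n ⊕ Fin n} {Φ Φ' g g' : Obs n}
    (h : HasWeakDeriv i Φ g) (h' : HasWeakDeriv i Φ' g') :
    HasWeakDeriv i (Φ + Φ') (g + g') := by
  have e := AEEqFun.coeFn_add Φ Φ'
  have e' := AEEqFun.coeFn_add g g'
  refine ⟨(h.1.add h'.1).congr e.symm, (h.2.1.add h'.2.1).congr e'.symm, ?_⟩
  intro ψ hψ hc
  have e1 : ∫ z, (fderiv ℝ ψ z (EuclideanSpace.single i 1)) • (Φ + Φ') z =
      ∫ z, ((fderiv ℝ ψ z (EuclideanSpace.single i 1)) • Φ z +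
        (fderiv ℝ ψ z (EuclideanSpace.single i 1)) • Φ' z) := by
    refine integral_congr_ae ?_
    filter_upwards [e] with z hz
    rw [hz, Pi.add_apply, smul_add]
  have e2 : ∫ z, ψ z • (g + g') z = ∫ z, (ψ z • g z + ψ z • g' z) := by
    refine integral_congr_ae ?_
    filter_upwards [e'] with z hz
    rw [hz, Pi.add_apply, smul_add]
  rw [e1, e2, integral_add (integrable_test_fderiv_smul h.1 hψ hc _)
    (integrable_test_fderiv_smul h'.1 hψ hc _),
    integral_add (integrable_test_smul h.2.1 hψ.continuous hc)
    (integrable_test_smul h'.2.1 hψ.continuous hc), h.2.2 ψ hψ hc, h'.2.2 ψ hψ hc, neg_add]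

theorem HasWeakDeriv.const_smul {n : ℕ} {i : Fin n ⊕ Fin n} {Φ g : Obs n} (c : ℂ)
    (h : HasWeakDeriv i Φ g) : HasWeakDeriv i (c • Φ) (c • g) := by
  have e := AEEqFun.coeFn_smul c Φ
  have e' := AEEqFun.coeFn_smul c g
  refine ⟨(h.1.smul c).congr e.symm, (h.2.1.smul c).congr e'.symm, ?_⟩
  intro ψ hψ hc
  have e1 : ∫ z, (fderiv ℝ ψ z (EuclideanSpace.single i 1)) • (c • Φ) z =
      ∫ z, c • ((fderiv ℝ ψ z (EuclideanSpace.single i 1)) • Φ z) := by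
    refine integral_congr_ae ?_
    filter_upwards [e] with z hz
    rw [hz, Pi.smul_apply, smul_comm]
  have e2 : ∫ z, ψ z • (c • g) z = ∫ z, c • (ψ z • g z) := by
    refine integral_congr_ae ?_
    filter_upwards [e'] with z hz
    rw [hz, Pi.smul_apply, smul_comm]
  rw [e1, e2, integral_smul, integral_smul, h.2.2 ψ hψ hc, smul_neg]

open Classical in
/-- The weak partial derivative `∂ᵢ Φ` (by convention `0` where `Φ` has none). -/
def weakDeriv {n : ℕ} (i : Fin n ⊕ Fin n) (Φ : Obs n) : Obs n :=
  if h : ∃ g, HasWeakDeriv i Φ g then h.choose else 0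

theorem HasWeakDeriv.weakDeriv_eq {n : ℕ} {i : Fin n ⊕ Fin n} {Φ g : Obs n}
    (h : HasWeakDeriv i Φ g) : weakDeriv i Φ = g := by
  have h' : ∃ g, HasWeakDeriv i Φ g := ⟨g, h⟩
  rw [weakDeriv, dif_pos h']
  exact h'.choose_spec.unique h

/-- `Φ` and its weak derivatives up to order `k` lie in `L^p`. -/
def MemSobolev {n : ℕ} : ℕ → ℝ≥0∞ → Obs n → Prop
  | 0, p, Φ => MemLp (fun z => Φ z) p volume
  | k + 1, p, Φ => MemLp (fun z => Φ z) p volume ∧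
      ∀ i, ∃ g, HasWeakDeriv i Φ g ∧ MemSobolev k p g

theorem MemSobolev.add {n : ℕ} {p : ℝ≥0∞} : ∀ {k : ℕ} {Φ Φ' : Obs n},
    MemSobolev k p Φ → MemSobolev k p Φ' → MemSobolev k p (Φ + Φ')
  | 0, Φ, Φ', h, h' => (MemLp.add h h').ae_eq (AEEqFun.coeFn_add Φ Φ').symm
  | k + 1, Φ, Φ', h, h' => by
      refine ⟨(h.1.add h'.1).ae_eq (AEEqFun.coeFn_add Φ Φ').symm, fun i => ?_⟩
      obtain ⟨g, hg, hk⟩ := h.2 i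
      obtain ⟨g', hg', hk'⟩ := h'.2 i
      exact ⟨g + g', hg.add hg', hk.add hk'⟩

theorem MemSobolev.const_smul {n : ℕ} {p : ℝ≥0∞} (c : ℂ) : ∀ {k : ℕ} {Φ : Obs n},
    MemSobolev k p Φ → MemSobolev k p (c • Φ)
  | 0, Φ, h => (MemLp.const_smul h c).ae_eq (AEEqFun.coeFn_smul c Φ).symm
  | k + 1, Φ, h => by
      refine ⟨(h.1.const_smul c).ae_eq (AEEqFun.coeFn_smul c Φ).symm, fun i => ?_⟩
      obtain ⟨g, hg, hk⟩ := h.2 i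
      exact ⟨c • g, hg.const_smul c, hk.const_smul c⟩

theorem hasWeakDeriv_zero {n : ℕ} (i : Fin n ⊕ Fin n) : HasWeakDeriv i (0 : Obs n) 0 := by
  have e : (fun _ => (0 : ℂ)) =ᵐ[volume] ((0 : Obs n) : Phase n → ℂ) := AEEqFun.coeFn_zero.symm
  have hl : LocallyIntegrable (fun z => (0 : Obs n) z) (volume : Measure (Phase n)) :=
    locallyIntegrable_zero.congr e
  refine ⟨hl, hl, fun ψ _ _ => ?_⟩
  rw [integral_eq_zero_of_ae, integral_eq_zero_of_ae, neg_zero]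
  · filter_upwards [e] with z hz
    rw [← hz, smul_zero, Pi.zero_apply]
  · filter_upwards [e] with z hz
    rw [← hz, smul_zero, Pi.zero_apply]

theorem memSobolev_zero {n : ℕ} {p : ℝ≥0∞} : ∀ {k : ℕ}, MemSobolev k p (0 : Obs n)
  | 0 => (MemLp.zero' : MemLp (fun _ => (0 : ℂ)) p volume).ae_eq AEEqFun.coeFn_zero.symm
  | _ + 1 => ⟨(MemLp.zero' : MemLp (fun _ => (0 : ℂ)) p volume).ae_eq AEEqFun.coeFn_zero.symm,
      fun i => ⟨0, hasWeakDeriv_zero i, memSobolev_zero⟩⟩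

/-- The Sobolev space `W_{k,p}` of complex-valued functions on `ℝ^{2n}`. -/
def W (n k : ℕ) (p : ℝ≥0∞) : Submodule ℂ (Obs n) where
  carrier := {Φ | MemSobolev k p Φ}
  add_mem' h h' := h.add h'
  zero_mem' := memSobolev_zero
  smul_mem' c _ h := h.const_smul c

/-! ### The bilinear form `ω` and symplectic adjoints -/

/-- The block matrix `Ω = (0, I; -I, 0)`. -/
def Omega (n : ℕ) : Matrix (Fin n ⊕ Fin n) (Fin n ⊕ Fin n) ℂ :=
  Matrix.fromBlocks 0 1 (-1) 0

/-- The function `z ↦ ∇φ(z)ᵀ Ω ∇Φ(z)`. -/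
def omegaIntegrand {n : ℕ} (φ Φ : Obs n) (z : Phase n) : ℂ :=
  (fun i => weakDeriv i φ z) ⬝ᵥ (Omega n *ᵥ fun i => weakDeriv i Φ z)

/-- The form `ω(φ, Φ) = ∫ ∇φ(z)ᵀ Ω ∇Φ(z) dz`. The integral converges absolutely for
`φ, Φ ∈ W_{1,2}`. -/
def omega {n : ℕ} (φ Φ : Obs n) : ℂ :=
  ∫ z, omegaIntegrand φ Φ z

/-- `B` is a symplectic adjoint of `A`, for linear operators `A`, `B` in `(W_{1,2}, ω)` with a
common domain of definition `D`: one has `ω(φ, A Φ) = ω(B φ, Φ)` for all `φ, Φ ∈ D`. -/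
def IsSymplecticAdjoint {n : ℕ} (A B : W n 1 2 →ₗ.[ℂ] W n 1 2) : Prop :=
  B.domain = A.domain ∧
  ∀ (φ : B.domain) (Φ : A.domain),
    omega (φ : Obs n) (A Φ : Obs n) = omega (B φ : Obs n) (Φ : Obs n)

/-! ### The Koopman generator -/

open Classical in
/-- The class of the `i`-th component of a vector field `F` (by convention `0` if that component
is not measurable, which does not happen for continuous `F`). -/
def component {n : ℕ} (F : Phase n → Phase n) (i : Fin n ⊕ Fin n) : Obs n :=
  if h : AEStronglyMeasurable (fun z => (F z i : ℂ)) volume then AEEqFun.mk _ h else 0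

/-- The differential expression `Φ ↦ Fᵀ ∇Φ` on `W_{1,2}`, with values in the measurable
functions. -/
def advection {n : ℕ} (F : Phase n → Phase n) : W n 1 2 →ₗ[ℂ] Obs n where
  toFun Φ := ∑ i, component F i * weakDeriv i (Φ : Obs n)
  map_add' Φ Φ' := by
    rw [← Finset.sum_add_distrib]
    refine Finset.sum_congr rfl fun i _ => ?_
    obtain ⟨g, hg, -⟩ := Φ.2.2 i
    obtain ⟨g', hg', -⟩ := Φ'.2.2 i
    rw [Submodule.coe_add, (hg.add hg').weakDeriv_eq, hg.weakDeriv_eq, hg'.weakDeriv_eq]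
    refine AEEqFun.ext ?_
    filter_upwards [AEEqFun.coeFn_mul (component F i) (g + g'), AEEqFun.coeFn_add g g',
      AEEqFun.coeFn_add (component F i * g) (component F i * g'),
      AEEqFun.coeFn_mul (component F i) g, AEEqFun.coeFn_mul (component F i) g']
      with z h1 h2 h3 h4 h5
    rw [h1, h3, Pi.mul_apply, Pi.add_apply, h2, h4, h5, Pi.add_apply, Pi.mul_apply,
      Pi.mul_apply, mul_add]
  map_smul' c Φ := by
    rw [RingHom.id_apply, Finset.smul_sum]
    refine Finset.sum_congr rfl fun i _ => ?_
    obtain ⟨g, hg, -⟩ := Φ.2.2 i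
    rw [Submodule.coe_smul, (hg.const_smul c).weakDeriv_eq, hg.weakDeriv_eq]
    refine AEEqFun.ext ?_
    filter_upwards [AEEqFun.coeFn_mul (component F i) (c • g), AEEqFun.coeFn_smul c g,
      AEEqFun.coeFn_smul c (component F i * g), AEEqFun.coeFn_mul (component F i) g]
      with z h1 h2 h3 h4
    rw [h1, h3, Pi.mul_apply, Pi.smul_apply, h2, h4, Pi.smul_apply, Pi.mul_apply, smul_eq_mul,
      smul_eq_mul, mul_left_comm]

/-- The Koopman generator `L Φ = Fᵀ ∇Φ` as an operator in `W_{1,2}`, with its natural domain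
inside `W_{2,2}`: those `Φ ∈ W_{2,2}` with `Fᵀ ∇Φ ∈ W_{1,2}`. -/
def generator {n : ℕ} (F : Phase n → Phase n) : W n 1 2 →ₗ.[ℂ] W n 1 2 where
  domain := (W n 2 2).comap (W n 1 2).subtype ⊓ (W n 1 2).comap (advection F)
  toFun :=
    { toFun := fun Φ => ⟨advection F Φ.1, Φ.2.2⟩
      map_add' := fun Φ Φ' => Subtype.ext ((advection F).map_add Φ.1 Φ'.1)
      map_smul' := fun c Φ => Subtype.ext ((advection F).map_smul c Φ.1) }

end PontryaginKoopman

end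

set_option linter.unusedSectionVars false

namespace PontryaginKoopman

/-! ### Weak derivatives tested against Lipschitz functions. -/

section WeakCalculus

open Filter Metric Set ContinuousLinearMap
open scoped Topology Convolution NNReal

/-! Write {φ, Φ} for ∇φᵀ Ω ∇Φ. The adjoint identity holds for two different reasons, on D(L) and
beyond it.

On D(L) both sides are zero. For φ ∈ W_{2,2} and Φ ∈ W_{1,2}, integration by parts turns ∫ ∂ₐφ ∂_bΦ
into -∫ ∂_b∂ₐφ Φ, which is symmetric in a and b, while Ω is antisymmetric; so ω(φ, Φ) = 0
(`omega_eq_zero`).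

Optimal control enters through h(x, λ) = min_u H(x, u, λ). The implicit function theorem for H_u = 0
makes u⋆ continuously differentiable, and the envelope theorem then gives h ∈ C² and F = Ω∇h
(`exists_isHamiltonianField`). Hence F is C¹, and the product rule yields the weak derivatives of
LΦ, which lie in L² when Φ has compact support.

Outside D(L) the function LΦ need not be in W_{1,2}. Since F is Hamiltonian, {φ, LΦ} + {Lφ, Φ} =
Fᵀ∇{φ, Φ} almost everywhere (`IsHamiltonianField.omegaIntegrand_advection_add`), and it remains to
show ∫ Fᵀ∇g = 0 for g = {φ, Φ} ∈ L¹ (`IsFlow.integral_advection_eq_zero`). Plain cutoffs ψ_k do not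
suffice, because F may grow arbitrarily fast and Fᵀ∇ψ_k is not controlled. Their averages χ_k = ∫₀¹
ψ_k ∘ Γ_s ds satisfy Fᵀ∇χ_k = ψ_k ∘ Γ₁ - ψ_k, which is bounded by 2 and tends to 0 pointwise. As div
F = 0, integration by parts and dominated convergence conclude. The χ_k are only shown to be
Lipschitz, so weak derivatives must be tested against Lipschitz functions. -/

theorem exists_radius_of_hasCompactSupport {E : Type*} [NormedAddCommGroup E] {χ : E → ℝ} (hχ : HasCompactSupport χ) :
    ∃ R, 0 ≤ R ∧ ∀ x, R < ‖x‖ → x ∉ tsupport χ := by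
  obtain ⟨R, hR⟩ := hχ.isCompact.isBounded.exists_norm_le
  exact ⟨max R 0, le_max_right _ _, fun x hx hx' => absurd (hR x hx')
    (not_le.2 (lt_of_le_of_lt (le_max_left _ _) hx))⟩

theorem lineDeriv_eq_zero_of_notMem_tsupport {E : Type*} [NormedAddCommGroup E] [NormedSpace ℝ E]
    {χ : E → ℝ} {x : E} (hx : x ∉ tsupport χ) (v : E) :
    lineDeriv ℝ χ x v = 0 := by
  rw [(notMem_tsupport_iff_eventuallyEq.1 hx).lineDeriv_eq]
  simp [lineDeriv]

variable {E : Type*} [NormedAddCommGroup E] [NormedSpace ℝ E] [FiniteDimensional ℝ E]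
  [MeasurableSpace E] [BorelSpace E] {μ : Measure E} [μ.IsAddHaarMeasure]
  {G : Type*} [NormedAddCommGroup G] [NormedSpace ℝ G]

/-! ### Weak directional derivatives and mollification -/

/-- `u'` is the weak derivative of `u` in the direction `v`. -/
def HasWeakLineDeriv (μ : Measure E) (v : E) (u u' : E → G) : Prop :=
  LocallyIntegrable u μ ∧ LocallyIntegrable u' μ ∧
  ∀ ψ : E → ℝ, ContDiff ℝ ∞ ψ → HasCompactSupport ψ →
    ∫ z, fderiv ℝ ψ z v • u z ∂μ = -∫ z, ψ z • u' z ∂μ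

/-- Convolution with a normalized bump function. -/
noncomputable def mollify (μ : Measure E) (φ : ContDiffBump (0 : E)) (u : E → G) : E → G :=
  φ.normed μ ⋆[lsmul ℝ ℝ, μ] u

theorem mollify_apply (φ : ContDiffBump (0 : E)) (u : E → G) (x : E) :
    mollify μ φ u x = ∫ t, φ.normed μ t • u (x - t) ∂μ := rfl

theorem mollify_apply_swap (φ : ContDiffBump (0 : E)) (u : E → G) (x : E) :
    mollify μ φ u x = ∫ t, φ.normed μ (x - t) • u t ∂μ := by
  rw [mollify, convolution_eq_swap]; rfl

theorem contDiff_mollify (φ : ContDiffBump (0 : E)) {u : E → G} (hu : LocallyIntegrable u μ) :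
    ContDiff ℝ ∞ (mollify μ φ u) :=
  φ.hasCompactSupport_normed.contDiff_convolution_left _ φ.contDiff_normed hu

theorem norm_mollify_le (φ : ContDiffBump (0 : E)) {u : E → G} {M : ℝ} (hu : ∀ x, ‖u x‖ ≤ M)
    (x : E) : ‖mollify μ φ u x‖ ≤ M := by
  have h : ‖mollify μ φ u x‖ ≤ ∫ t, φ.normed μ t * M ∂μ := by
    refine norm_integral_le_of_norm_le (φ.integrable_normed.mul_const M) ?_
    refine Eventually.of_forall fun t => ?_
    simp only [lsmul_apply, norm_smul, Real.norm_of_nonneg (φ.nonneg_normed t)]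
    exact mul_le_mul_of_nonneg_left (hu _) (φ.nonneg_normed t)
  rwa [integral_mul_const, φ.integral_normed, one_mul] at h

theorem mollify_eq_zero (φ : ContDiffBump (0 : E)) (hφ : φ.rOut ≤ 1) {u : E → G} {R : ℝ}
    (hu : ∀ x, R < ‖x‖ → u x = 0) {x : E} (hx : R + 1 < ‖x‖) : mollify μ φ u x = 0 := by
  rw [mollify_apply]
  refine integral_eq_zero_of_ae (Eventually.of_forall fun t => ?_)
  by_cases ht : t ∈ ball (0 : E) φ.rOut
  · have h1 : ‖t‖ < 1 := lt_of_lt_of_le (by simpa using ht) hφ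
    have h2 : R < ‖x - t‖ := by linarith [norm_sub_norm_le x t]
    simp [hu _ h2]
  · rw [← φ.support_normed_eq (μ := μ), Function.notMem_support] at ht
    simp [ht]

/-- The derivative falls on the kernel, and t ↦ ρ(x - t) is itself a test function, so the
definition of the weak derivative moves it onto `u`. -/
theorem fderiv_mollify (φ : ContDiffBump (0 : E)) {v : E} {u u' : E → G}
    (h : HasWeakLineDeriv μ v u u') (x : E) :
    fderiv ℝ (mollify μ φ u) x v = mollify μ φ u' x := by
  have hρ : ContDiff ℝ ∞ (φ.normed μ) := φ.contDiff_normed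
  have hc : HasCompactSupport (φ.normed μ) := φ.hasCompactSupport_normed
  have h1 := (hc.hasFDerivAt_convolution_left (lsmul ℝ ℝ) (hρ.of_le (by simp)) h.1 x).fderiv
  have hi := (hc.fderiv ℝ).convolutionExists_left ((lsmul ℝ ℝ : ℝ →L[ℝ] G →L[ℝ] G).precompL E)
    (hρ.continuous_fderiv (by simp)) h.1 x
  have hψ : ContDiff ℝ ∞ fun t => φ.normed μ (x - t) := hρ.comp (contDiff_const.sub contDiff_id)
  have hcψ : HasCompactSupport fun t => φ.normed μ (x - t) :=
    hc.comp_homeomorph (Homeomorph.subLeft x)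
  have hd : ∀ t, fderiv ℝ (fun t => φ.normed μ (x - t)) t v = -fderiv ℝ (φ.normed μ) (x - t) v := by
    intro t
    have := ((hρ.differentiable (by simp) (x - t)).hasFDerivAt.comp t
      ((hasFDerivAt_const x t).sub (hasFDerivAt_id t))).fderiv
    rw [show (fun t => φ.normed μ (x - t)) = φ.normed μ ∘ (HSub.hSub x) from rfl, this]
    simp
  have h3 := h.2.2 _ hψ hcψ
  simp only [hd, neg_smul, integral_neg, neg_inj] at h3
  rw [mollify, h1, convolution_def, ContinuousLinearMap.integral_apply hi.integrable]
  simp only [precompL_apply, lsmul_apply]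
  rw [mollify_apply_swap, ← h3, ← integral_sub_left_eq_self _ μ x]
  simp

/-- The bounded ratio of the radii gives almost everywhere convergence of mollifications; `rOut ≤ 1`
enlarges supports by at most 1. -/
theorem exists_bump_seq (E : Type*) [NormedAddCommGroup E] [NormedSpace ℝ E] :
    ∃ φ : ℕ → ContDiffBump (0 : E), Tendsto (fun k => (φ k).rOut) atTop (𝓝 0) ∧
      (∀ k, (φ k).rOut ≤ 2 * (φ k).rIn) ∧ ∀ k, (φ k).rOut ≤ 1 := by
  refine ⟨fun k => ⟨1 / (2 * ((k : ℝ) + 1)), 1 / ((k : ℝ) + 1), by positivity, ?_⟩, ?_, ?_, ?_⟩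
  · apply one_div_lt_one_div_of_lt <;> linarith [(Nat.cast_nonneg k : (0 : ℝ) ≤ k)]
  · exact tendsto_one_div_add_atTop_nhds_zero_nat
  · intro k
    apply le_of_eq
    field_simp
  · intro k
    simp only
    rw [div_le_one (by positivity)]
    linarith [(Nat.cast_nonneg k : (0 : ℝ) ≤ k)]

/-- Dominated convergence: the mollifications of `c` converge almost everywhere, stay below `M` and
vanish outside the ball of radius R + 1, so local integrability of `w` suffices. -/
theorem tendsto_integral_mollify_smul {φ : ℕ → ContDiffBump (0 : E)}
    (h0 : Tendsto (fun k => (φ k).rOut) atTop (𝓝 0)) (h2 : ∀ k, (φ k).rOut ≤ 2 * (φ k).rIn)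
    (h1 : ∀ k, (φ k).rOut ≤ 1) {c : E → ℝ} {M R : ℝ} (hc : LocallyIntegrable c μ)
    (hM : ∀ x, ‖c x‖ ≤ M) (hR : ∀ x, R < ‖x‖ → c x = 0) {w : E → G}
    (hw : LocallyIntegrable w μ) :
    Tendsto (fun k => ∫ x, mollify μ (φ k) c x • w x ∂μ) atTop (𝓝 (∫ x, c x • w x ∂μ)) := by
  refine tendsto_integral_of_dominated_convergence
    (fun x => (closedBall (0 : E) (R + 1)).indicator (fun x => M * ‖w x‖) x) ?_ ?_ ?_ ?_
  · exact fun k => ((contDiff_mollify (φ k) hc).continuous.aestronglyMeasurable).smul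
      hw.aestronglyMeasurable
  · rw [integrable_indicator_iff measurableSet_closedBall]
    exact ((hw.integrableOn_isCompact (isCompact_closedBall _ _)).norm).const_mul M
  · refine fun k => Eventually.of_forall fun x => ?_
    by_cases hx : x ∈ closedBall (0 : E) (R + 1)
    · rw [indicator_of_mem hx, norm_smul]
      exact mul_le_mul_of_nonneg_right (norm_mollify_le (φ k) hM x) (norm_nonneg _)
    · rw [indicator_of_notMem hx, mollify_eq_zero (φ k) (h1 k) hR (by simpa using hx)]
      simp
  · filter_upwards [ContDiffBump.ae_convolution_tendsto_right_of_locallyIntegrable (K := 2) h0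
      (Eventually.of_forall h2) hc] with x hx
    exact hx.smul_const _

theorem _root_.LipschitzWith.hasWeakLineDeriv {χ : E → ℝ} {C : ℝ≥0} (hχ : LipschitzWith C χ)
    (v : E) : HasWeakLineDeriv μ v χ (fun x => lineDeriv ℝ χ x v) := by
  refine ⟨hχ.continuous.locallyIntegrable, hχ.locallyIntegrable_lineDeriv v, fun ψ hψ hc => ?_⟩
  obtain ⟨D, hD⟩ := hψ.lipschitzWith_of_hasCompactSupport hc (by simp)
  have h := hχ.integral_lineDeriv_mul_eq (μ := μ) hD hc v
  simp only [smul_eq_mul, mul_comm (ψ _), h, ← integral_neg]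
  refine integral_congr_ae (Eventually.of_forall fun x => ?_)
  simp [((hψ.differentiable (by simp)) x).lineDeriv_eq_fderiv]

/-- Mollify the test function: the line derivative of a Lipschitz function is its weak derivative,
hence commutes with mollification, and both sides pass to the limit. -/
theorem HasWeakLineDeriv.integral_lineDeriv_smul {v : E} {u u' : E → G}
    (h : HasWeakLineDeriv μ v u u') {χ : E → ℝ} {C : ℝ≥0} (hχ : LipschitzWith C χ)
    (hc : HasCompactSupport χ) :
    ∫ z, lineDeriv ℝ χ z v • u z ∂μ = -∫ z, χ z • u' z ∂μ := by
  obtain ⟨φ, h0, h2, h1⟩ := exists_bump_seq E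
  obtain ⟨R, -, hR⟩ := exists_radius_of_hasCompactSupport hc
  obtain ⟨M, hM⟩ := hc.exists_bound_of_continuous hχ.continuous
  have hw := hχ.hasWeakLineDeriv (μ := μ) v
  have t1 := tendsto_integral_mollify_smul h0 h2 h1 hw.2.1
    (fun x => norm_lineDeriv_le_of_lipschitz ℝ hχ)
    (fun x hx => lineDeriv_eq_zero_of_notMem_tsupport (hR x hx) v) h.1
  have hR0 : ∀ x, R < ‖x‖ → χ x = 0 := fun x hx => image_eq_zero_of_notMem_tsupport (hR x hx)
  have t2 := tendsto_integral_mollify_smul h0 h2 h1 hw.1 hM hR0 h.2.1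
  refine tendsto_nhds_unique t1 (t2.neg.congr fun k => ?_)
  have hs : HasCompactSupport (mollify μ (φ k) χ) :=
    HasCompactSupport.intro (isCompact_closedBall (0 : E) (R + 1)) fun x hx =>
      mollify_eq_zero (φ k) (h1 k) hR0 (by simpa using hx)
  rw [← h.2.2 _ (contDiff_mollify (φ k) hw.1) hs]
  simp only [fderiv_mollify (φ k) hw]

end WeakCalculus

/-! ### Product rule with a C¹ factor; mollification in L². -/

section WeakProducts

open Filter Metric Set ContinuousLinearMap
open scoped Topology Convolution NNReal

variable {E : Type*} [NormedAddCommGroup E] [NormedSpace ℝ E] [FiniteDimensional ℝ E]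
  [MeasurableSpace E] [BorelSpace E] {μ : Measure E} [μ.IsAddHaarMeasure]
  {G : Type*} [NormedAddCommGroup G] [NormedSpace ℝ G]

theorem HasWeakLineDeriv.congr {v : E} {u u' w w' : E → G} (h : HasWeakLineDeriv μ v u u')
    (hu : u =ᵐ[μ] w) (hu' : u' =ᵐ[μ] w') : HasWeakLineDeriv μ v w w' := by
  refine ⟨h.1.congr hu, h.2.1.congr hu', fun ψ hψ hc => ?_⟩
  have e1 : ∫ z, fderiv ℝ ψ z v • w z ∂μ = ∫ z, fderiv ℝ ψ z v • u z ∂μ :=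
    integral_congr_ae (hu.mono fun z hz => by simp [hz])
  have e2 : ∫ z, ψ z • w' z ∂μ = ∫ z, ψ z • u' z ∂μ :=
    integral_congr_ae (hu'.mono fun z hz => by simp [hz])
  rw [e1, e2, h.2.2 ψ hψ hc]

theorem integrable_fderiv_smul {u : E → G} (hu : LocallyIntegrable u μ) {ψ : E → ℝ}
    (hψ : ContDiff ℝ ∞ ψ) (hc : HasCompactSupport ψ) (v : E) :
    Integrable (fun z => fderiv ℝ ψ z v • u z) μ :=
  hu.integrable_smul_left_of_hasCompactSupport
    ((hψ.continuous_fderiv (by simp)).clm_apply continuous_const) (hc.fderiv_apply ℝ v)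

theorem HasWeakLineDeriv.add {v : E} {u u' w w' : E → G} (h : HasWeakLineDeriv μ v u u')
    (k : HasWeakLineDeriv μ v w w') :
    HasWeakLineDeriv μ v (fun z => u z + w z) (fun z => u' z + w' z) := by
  refine ⟨h.1.add k.1, h.2.1.add k.2.1, fun ψ hψ hc => ?_⟩
  simp only [smul_add]
  rw [integral_add (integrable_fderiv_smul h.1 hψ hc v) (integrable_fderiv_smul k.1 hψ hc v),
    integral_add (h.2.1.integrable_smul_left_of_hasCompactSupport hψ.continuous hc)
      (k.2.1.integrable_smul_left_of_hasCompactSupport hψ.continuous hc),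
    h.2.2 ψ hψ hc, k.2.2 ψ hψ hc, neg_add]

theorem HasWeakLineDeriv.clm {H : Type*} [NormedAddCommGroup H] [NormedSpace ℝ H]
    [CompleteSpace G] [CompleteSpace H] {v : E} {u u' : E → G} (h : HasWeakLineDeriv μ v u u')
    (L : G →L[ℝ] H) : HasWeakLineDeriv μ v (fun z => L (u z)) (fun z => L (u' z)) := by
  refine ⟨?_, ?_, fun ψ hψ hc => ?_⟩
  · exact fun x => (h.1 x).imp fun s hs => ⟨hs.1, L.integrable_comp hs.2⟩
  · exact fun x => (h.2.1 x).imp fun s hs => ⟨hs.1, L.integrable_comp hs.2⟩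
  · simp only [← L.map_smul]
    rw [L.integral_comp_comm (integrable_fderiv_smul h.1 hψ hc v), L.integral_comp_comm
      (h.2.1.integrable_smul_left_of_hasCompactSupport hψ.continuous hc), h.2.2 ψ hψ hc, map_neg]

theorem hasWeakLineDeriv_zero (v : E) :
    HasWeakLineDeriv μ v (fun _ => (0 : G)) (fun _ => (0 : G)) :=
  ⟨locallyIntegrable_zero, locallyIntegrable_zero, fun _ _ _ => by simp⟩

theorem HasWeakLineDeriv.sum {ι : Type*} (s : Finset ι) {v : E} {u u' : ι → E → G}
    (h : ∀ i ∈ s, HasWeakLineDeriv μ v (u i) (u' i)) :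
    HasWeakLineDeriv μ v (fun z => ∑ i ∈ s, u i z) (fun z => ∑ i ∈ s, u' i z) := by
  classical
  induction s using Finset.induction_on with
  | empty => simpa using hasWeakLineDeriv_zero v
  | insert a s ha ih =>
    simp only [Finset.sum_insert ha]
    exact (h a (by simp)).add (ih fun i hi => h i (by simp [hi]))

/-- The product rule for a continuously differentiable and a weakly differentiable factor. -/
theorem HasWeakLineDeriv.contDiff_smul [CompleteSpace G] {v : E} {u u' : E → G}
    (h : HasWeakLineDeriv μ v u u') {a : E → ℝ} (ha : ContDiff ℝ 1 a) :
    HasWeakLineDeriv μ v (fun z => a z • u z) (fun z => fderiv ℝ a z v • u z + a z • u' z) := by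
  have hda : Continuous fun z => fderiv ℝ a z v :=
    (ha.continuous_fderiv (by simp)).clm_apply continuous_const
  refine ⟨h.1.continuous_smul ha.continuous,
    (h.1.continuous_smul hda).add (h.2.1.continuous_smul ha.continuous), fun ψ hψ hc => ?_⟩
  -- The product ψa is only C¹, hence not a smooth test function, but it is an admissible Lipschitz
  -- one.
  have hχ : ContDiff ℝ 1 fun z => ψ z * a z := (hψ.of_le (by simp)).mul ha
  have hcχ : HasCompactSupport fun z => ψ z * a z := hc.mul_right
  obtain ⟨C, hC⟩ := hχ.lipschitzWith_of_hasCompactSupport hcχ (by simp)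
  have hd : ∀ z, lineDeriv ℝ (fun z => ψ z * a z) z v =
      fderiv ℝ ψ z v * a z + ψ z * fderiv ℝ a z v := by
    intro z
    rw [((hχ.differentiable (by simp)) z).lineDeriv_eq_fderiv,
      fderiv_fun_mul (hψ.differentiable (by simp) z) (ha.differentiable (by simp) z)]
    simp
    ring
  have i1 := integrable_fderiv_smul (h.1.continuous_smul ha.continuous) hψ hc v
  have i2 : Integrable (fun z => ψ z • fderiv ℝ a z v • u z) μ :=
    (h.1.continuous_smul hda).integrable_smul_left_of_hasCompactSupport hψ.continuous hc
  have i3 : Integrable (fun z => ψ z • a z • u' z) μ :=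
    (h.2.1.continuous_smul ha.continuous).integrable_smul_left_of_hasCompactSupport
      hψ.continuous hc
  have key := h.integral_lineDeriv_smul hC hcχ
  simp only [hd, add_smul, mul_smul] at key
  rw [integral_add i1 i2] at key
  simp only [smul_add]
  rw [integral_add i2 i3, neg_add, ← key]
  abel

theorem eLpNorm_two_sq (u : E → G) : eLpNorm u 2 μ ^ 2 = ∫⁻ x, ‖u x‖ₑ ^ 2 ∂μ := by
  simpa using eLpNorm_nnreal_pow_eq_lintegral (f := u) (μ := μ) (p := 2) (by simp)

/-- Jensen's inequality: ρ dμ is a probability measure, for which the L¹ norm is at most the L²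
norm. -/
theorem enorm_mollify_sq_le (φ : ContDiffBump (0 : E)) {u : E → G}
    (hu : AEStronglyMeasurable u μ) (x : E) :
    ‖mollify μ φ u x‖ₑ ^ 2 ≤ ∫⁻ t, ‖φ.normed μ t‖ₑ * ‖u (x - t)‖ₑ ^ 2 ∂μ := by
  set ρ : E → ℝ := φ.normed μ
  have hρm : Measurable ρ := φ.continuous_normed.measurable
  set ν : Measure E := μ.withDensity fun t => ‖ρ t‖ₑ
  have hν : IsProbabilityMeasure ν := by
    constructor
    rw [withDensity_apply _ MeasurableSet.univ, Measure.restrict_univ]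
    have h1 : ∫⁻ t, ‖ρ t‖ₑ ∂μ = ENNReal.ofReal (∫ t, ρ t ∂μ) := by
      rw [ofReal_integral_eq_lintegral_ofReal φ.integrable_normed
        (Eventually.of_forall φ.nonneg_normed)]
      exact lintegral_congr fun t => Real.enorm_of_nonneg (φ.nonneg_normed t)
    rw [h1, φ.integral_normed, ENNReal.ofReal_one]
  have hm : AEStronglyMeasurable (fun t => u (x - t)) μ :=
    hu.comp_quasiMeasurePreserving (quasiMeasurePreserving_sub_left_of_right_invariant μ x)
  have hmν : AEStronglyMeasurable (fun t => u (x - t)) ν :=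
    hm.mono_ac (withDensity_absolutelyContinuous _ _)
  have h2 : ‖mollify μ φ u x‖ₑ ≤ eLpNorm (fun t => u (x - t)) 1 ν := by
    rw [eLpNorm_one_eq_lintegral_enorm,
      lintegral_withDensity_eq_lintegral_mul₀ hρm.enorm.aemeasurable hm.enorm]
    refine (enorm_integral_le_lintegral_enorm _).trans (le_of_eq ?_)
    exact lintegral_congr fun t => by simp [enorm_smul, ρ]
  have h3 := eLpNorm_le_eLpNorm_of_exponent_le (one_le_two : (1 : ℝ≥0∞) ≤ 2) hmν
  refine (pow_le_pow_left' (h2.trans h3) 2).trans (le_of_eq ?_)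
  rw [show eLpNorm (fun t => u (x - t)) 2 ν ^ 2 = ∫⁻ t, ‖u (x - t)‖ₑ ^ 2 ∂ν by
    simpa using eLpNorm_nnreal_pow_eq_lintegral (f := fun t => u (x - t)) (μ := ν) (p := 2)
      (by simp)]
  rw [lintegral_withDensity_eq_lintegral_mul₀ hρm.enorm.aemeasurable (hm.enorm.pow_const 2)]
  rfl

/-- Mollification does not increase the `L²` norm. -/
theorem eLpNorm_mollify_le (φ : ContDiffBump (0 : E)) {u : E → G}
    (hu : AEStronglyMeasurable u μ) : eLpNorm (mollify μ φ u) 2 μ ≤ eLpNorm u 2 μ := by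
  rw [← ENNReal.pow_le_pow_left_iff two_ne_zero, eLpNorm_two_sq, eLpNorm_two_sq]
  have hρm : Measurable (φ.normed μ) := φ.continuous_normed.measurable
  calc ∫⁻ x, ‖mollify μ φ u x‖ₑ ^ 2 ∂μ
      ≤ ∫⁻ x, ∫⁻ t, ‖φ.normed μ t‖ₑ * ‖u (x - t)‖ₑ ^ 2 ∂μ ∂μ :=
        lintegral_mono fun x => enorm_mollify_sq_le φ hu x
    _ = ∫⁻ t, ∫⁻ x, ‖φ.normed μ t‖ₑ * ‖u (x - t)‖ₑ ^ 2 ∂μ ∂μ := by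
        refine lintegral_lintegral_swap ?_
        have h1 : AEStronglyMeasurable (fun p : E × E => u (p.1 - p.2)) (μ.prod μ) :=
          hu.comp_quasiMeasurePreserving (quasiMeasurePreserving_sub μ μ)
        exact ((hρm.comp measurable_snd).enorm.aemeasurable).mul (h1.enorm.pow_const 2)
    _ = ∫⁻ t, ‖φ.normed μ t‖ₑ * ∫⁻ x, ‖u x‖ₑ ^ 2 ∂μ ∂μ := by
        refine lintegral_congr fun t => ?_
        rw [lintegral_const_mul' _ _ enorm_ne_top,
          lintegral_sub_right_eq_self (fun x => ‖u x‖ₑ ^ 2) t]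
    _ = ∫⁻ x, ‖u x‖ₑ ^ 2 ∂μ := by
        rw [lintegral_mul_const _ hρm.enorm]
        have h1 : ∫⁻ t, ‖φ.normed μ t‖ₑ ∂μ = ENNReal.ofReal (∫ t, φ.normed μ t ∂μ) := by
          rw [ofReal_integral_eq_lintegral_ofReal φ.integrable_normed
            (Eventually.of_forall φ.nonneg_normed)]
          exact lintegral_congr fun t => Real.enorm_of_nonneg (φ.nonneg_normed t)
        rw [h1, φ.integral_normed, ENNReal.ofReal_one, one_mul]

end WeakProducts

/-! ### L² convergence of mollifications and its consequences. -/

section WeakLimits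

open Filter Metric Set ContinuousLinearMap
open scoped Topology Convolution NNReal

variable {E : Type*} [NormedAddCommGroup E] [NormedSpace ℝ E] [FiniteDimensional ℝ E]
  [MeasurableSpace E] [BorelSpace E] {μ : Measure E} [μ.IsAddHaarMeasure]
  {G : Type*} [NormedAddCommGroup G] [NormedSpace ℝ G]

theorem mollify_sub (φ : ContDiffBump (0 : E)) {u w : E → G} (hu : LocallyIntegrable u μ)
    (hw : LocallyIntegrable w μ) : mollify μ φ (u - w) = mollify μ φ u - mollify μ φ w := by
  ext x
  have h : ∀ {u : E → G}, LocallyIntegrable u μ →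
      Integrable (fun t => φ.normed μ t • u (x - t)) μ := fun hu =>
    (φ.hasCompactSupport_normed.convolutionExists_left (lsmul ℝ ℝ) φ.continuous_normed hu x)
  simp only [Pi.sub_apply, mollify_apply, smul_sub]
  exact integral_sub (h hu) (h hw)

theorem tendsto_eLpNorm_mollify_sub_of_continuous [CompleteSpace G]
    {φ : ℕ → ContDiffBump (0 : E)} (h0 : Tendsto (fun k => (φ k).rOut) atTop (𝓝 0))
    (h1 : ∀ k, (φ k).rOut ≤ 1) {g : E → G} (hg : Continuous g) (hc : HasCompactSupport g) :
    Tendsto (fun k => eLpNorm (mollify μ (φ k) g - g) 2 μ) atTop (𝓝 0) := by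
  have hl : LocallyIntegrable g μ := hg.locallyIntegrable
  obtain ⟨R, hR⟩ := hc.isCompact.isBounded.exists_norm_le
  have hR0 : ∀ x, R < ‖x‖ → g x = 0 := fun x hx =>
    image_eq_zero_of_notMem_tsupport fun hx' => absurd (hR x hx') (not_le.2 hx)
  obtain ⟨M, hM⟩ := hc.exists_bound_of_continuous hg
  have hcont : ∀ k, Continuous (mollify μ (φ k) g - g) := fun k =>
    (contDiff_mollify (φ k) hl).continuous.sub hg
  have key : Tendsto (fun k => eLpNorm (mollify μ (φ k) g - g) 2 μ ^ 2) atTop (𝓝 0) := by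
    simp only [eLpNorm_two_sq]
    rw [show (0 : ℝ≥0∞) = ∫⁻ _ : E, 0 ∂μ by simp]
    refine tendsto_lintegral_of_dominated_convergence
      ((closedBall (0 : E) (R + 1)).indicator fun _ => ENNReal.ofReal (M + M) ^ 2) ?_ ?_ ?_ ?_
    · exact fun k => (hcont k).enorm.measurable.pow_const 2
    · refine fun k => Eventually.of_forall fun x => ?_
      by_cases hx : x ∈ closedBall (0 : E) (R + 1)
      · rw [indicator_of_mem hx]
        refine pow_le_pow_left' ?_ 2
        rw [← ofReal_norm]
        exact ENNReal.ofReal_le_ofReal ((norm_sub_le _ _).trans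
          (add_le_add (norm_mollify_le _ hM x) (hM x)))
      · have hx' : R + 1 < ‖x‖ := by simpa using hx
        simp [mollify_eq_zero (φ k) (h1 k) hR0 hx', hR0 x (by linarith)]
    · rw [lintegral_indicator measurableSet_closedBall, lintegral_const]
      refine ENNReal.mul_ne_top (by simp) ?_
      rw [Measure.restrict_apply_univ]
      exact (isCompact_closedBall _ _).measure_lt_top.ne
    · refine Eventually.of_forall fun x => ?_
      have h2 := (ContDiffBump.convolution_tendsto_right_of_continuous (μ := μ) h0 hg x).sub_const
        (g x)
      rw [sub_self] at h2
      have h3 := ((ENNReal.continuous_pow 2).tendsto _).comp h2.enorm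
      simpa [mollify, Function.comp_def] using h3
  have h4 := (ENNReal.continuous_rpow_const (y := 1 / 2)).tendsto 0 |>.comp key
  simp only [one_div, ENNReal.zero_rpow_of_pos (by norm_num : (0 : ℝ) < 2⁻¹)] at h4
  refine h4.congr fun k => ?_
  simp only [Function.comp]
  rw [← ENNReal.rpow_natCast, ← ENNReal.rpow_mul]
  norm_num

/-- Mollifications of an `L²` function converge in `L²`. -/
theorem tendsto_eLpNorm_mollify_sub [CompleteSpace G]
    {φ : ℕ → ContDiffBump (0 : E)} (h0 : Tendsto (fun k => (φ k).rOut) atTop (𝓝 0))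
    (h1 : ∀ k, (φ k).rOut ≤ 1) {u : E → G} (hu : MemLp u 2 μ) :
    Tendsto (fun k => eLpNorm (mollify μ (φ k) u - u) 2 μ) atTop (𝓝 0) := by
  rw [ENNReal.tendsto_nhds_zero]
  intro ε hε
  have hε3 : ε / 3 ≠ 0 := (ENNReal.div_pos hε.ne' (by simp)).ne'
  obtain ⟨g, hgc, hge, hg, hgL⟩ := hu.exists_hasCompactSupport_eLpNorm_sub_le (by simp) hε3
  have h2 := tendsto_eLpNorm_mollify_sub_of_continuous (μ := μ) h0 h1 hg hgc
  filter_upwards [(ENNReal.tendsto_nhds_zero.1 h2) (ε / 3) (pos_iff_ne_zero.2 hε3)] with k hk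
  have hul : LocallyIntegrable u μ := hu.locallyIntegrable one_le_two
  -- With `g` continuous, compactly supported and L²-close to `u`, the outer two terms are small
  -- because mollification is an L² contraction.
  have e : mollify μ (φ k) u - u =
      mollify μ (φ k) (u - g) + (mollify μ (φ k) g - g) - (u - g) := by
    rw [mollify_sub (φ k) hul hg.locallyIntegrable]
    abel
  have hm : AEStronglyMeasurable (mollify μ (φ k) (u - g)) μ :=
    (contDiff_mollify (φ k) (hul.sub hg.locallyIntegrable)).continuous.aestronglyMeasurable
  have hm' : AEStronglyMeasurable (mollify μ (φ k) g - g) μ :=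
    ((contDiff_mollify (φ k) hg.locallyIntegrable).continuous.sub hg).aestronglyMeasurable
  have hm'' : AEStronglyMeasurable (u - g) μ := (hu.sub hgL).1
  calc eLpNorm (mollify μ (φ k) u - u) 2 μ
      ≤ eLpNorm (mollify μ (φ k) (u - g) + (mollify μ (φ k) g - g)) 2 μ +
        eLpNorm (u - g) 2 μ := by
        rw [e]; exact eLpNorm_sub_le (hm.add hm') hm'' one_le_two
    _ ≤ eLpNorm (mollify μ (φ k) (u - g)) 2 μ + eLpNorm (mollify μ (φ k) g - g) 2 μ +
        eLpNorm (u - g) 2 μ := by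
        gcongr; exact eLpNorm_add_le hm hm' one_le_two
    _ ≤ ε / 3 + ε / 3 + ε / 3 := by
        gcongr; exact (eLpNorm_mollify_le (φ k) hm'').trans hge
    _ = ε := ENNReal.add_thirds ε

theorem memLp_mollify (φ : ContDiffBump (0 : E)) {u : E → G} (hu : MemLp u 2 μ) :
    MemLp (mollify μ φ u) 2 μ :=
  ⟨(contDiff_mollify φ (hu.locallyIntegrable one_le_two)).continuous.aestronglyMeasurable,
    (eLpNorm_mollify_le φ hu.1).trans_lt hu.2⟩

theorem integrable_mul_of_memLp_two {α : Type*} [MeasurableSpace α] {ν : Measure α} {u w : α → ℂ}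
    (hu : MemLp u 2 ν) (hw : MemLp w 2 ν) : Integrable (fun x => u x * w x) ν :=
  hu.integrable_mul hw

theorem tendsto_integral_mollify_mul
    {φ : ℕ → ContDiffBump (0 : E)} (h0 : Tendsto (fun k => (φ k).rOut) atTop (𝓝 0))
    (h1 : ∀ k, (φ k).rOut ≤ 1) {u w : E → ℂ} (hu : MemLp u 2 μ) (hw : MemLp w 2 μ) :
    Tendsto (fun k => ∫ x, mollify μ (φ k) u x * w x ∂μ) atTop (𝓝 (∫ x, u x * w x ∂μ)) := by
  have hm : ∀ k, MemLp (mollify μ (φ k) u) 2 μ := fun k => memLp_mollify (φ k) hu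
  refine tendsto_integral_of_L1' _ (integrable_mul_of_memLp_two hu hw).1
    (Eventually.of_forall fun k => integrable_mul_of_memLp_two (hm k) hw) ?_
  have h2 : Tendsto (fun k => eLpNorm (mollify μ (φ k) u - u) 2 μ * eLpNorm w 2 μ) atTop
      (𝓝 0) := by
    simpa using ENNReal.Tendsto.mul_const (tendsto_eLpNorm_mollify_sub h0 h1 hu)
      (Or.inr hw.2.ne)
  refine tendsto_of_tendsto_of_tendsto_of_le_of_le tendsto_const_nhds h2 (fun _ => zero_le) ?_
  intro k
  have h3 : eLpNorm ((mollify μ (φ k) u - u) • w) 1 μ ≤ _ :=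
    eLpNorm_smul_le_mul_eLpNorm (p := 2) (q := 2) (r := 1) hw.1 ((hm k).sub hu).1
  rwa [show (mollify μ (φ k) u - u) • w =
    (fun x => mollify μ (φ k) u x * w x) - fun x => u x * w x by ext x; simp [sub_mul]] at h3

/-- The product rule for a smooth complex and a weakly differentiable factor. -/
theorem HasWeakLineDeriv.contDiff_mul {v : E} {u u' : E → ℂ} (h : HasWeakLineDeriv μ v u u')
    {a : E → ℂ} (ha : ContDiff ℝ 1 a) :
    HasWeakLineDeriv μ v (fun z => a z * u z) (fun z => fderiv ℝ a z v * u z + a z * u' z) := by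
  -- Split a = Re a + i Im a and attach the factor i to `u`, which reduces to real multipliers.
  have hre := h.contDiff_smul (Complex.reCLM.contDiff.comp ha)
  have him := (h.clm ((ContinuousLinearMap.mul ℝ ℂ) Complex.I)).contDiff_smul
    (Complex.imCLM.contDiff.comp ha)
  have hd := fun z => (ha.differentiable (by simp) z).hasFDerivAt
  have e1 : ∀ z, fderiv ℝ (Complex.reCLM ∘ a) z v = (fderiv ℝ a z v).re := fun z => by
    rw [((Complex.reCLM.hasFDerivAt).comp z (hd z)).fderiv]; rfl
  have e2 : ∀ z, fderiv ℝ (Complex.imCLM ∘ a) z v = (fderiv ℝ a z v).im := fun z => by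
    rw [((Complex.imCLM.hasFDerivAt).comp z (hd z)).fderiv]; rfl
  have e3 : ∀ c w : ℂ, c.re • w + c.im • (Complex.I * w) = c * w := fun c w => by
    conv_rhs => rw [← Complex.re_add_im c]
    rw [Complex.real_smul, Complex.real_smul]
    ring
  refine (hre.add him).congr (Eventually.of_forall fun z => ?_) (Eventually.of_forall fun z => ?_)
  · exact e3 (a z) (u z)
  · simp only [e1, e2, ContinuousLinearMap.mul_apply']
    rw [add_add_add_comm, e3]
    congr 1
    exact e3 (a z) (u' z)

/-- The product rule for weakly differentiable functions in `L²`. -/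
theorem HasWeakLineDeriv.mul {v : E} {u u' w w' : E → ℂ} (h : HasWeakLineDeriv μ v u u')
    (k : HasWeakLineDeriv μ v w w') (hu : MemLp u 2 μ) (hu' : MemLp u' 2 μ) (hw : MemLp w 2 μ)
    (hw' : MemLp w' 2 μ) :
    HasWeakLineDeriv μ v (fun z => u z * w z) (fun z => u' z * w z + u z * w' z) := by
  refine ⟨(hu.integrable_mul hw).locallyIntegrable,
    ((hu'.integrable_mul hw).add (hu.integrable_mul hw')).locallyIntegrable, fun ψ hψ hc => ?_⟩
  obtain ⟨φ, h0, -, h1⟩ := exists_bump_seq E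
  have hb : ∀ {c : E → ℝ}, Continuous c → HasCompactSupport c → ∀ {f : E → ℂ}, MemLp f 2 μ →
      MemLp (fun z => c z • f z) 2 μ := by
    intro c hc hcs f hf
    obtain ⟨M, hM⟩ := hcs.exists_bound_of_continuous hc
    refine MemLp.of_le_mul (c := M) hf (hc.aestronglyMeasurable.smul hf.1)
      (Eventually.of_forall fun z => ?_)
    rw [norm_smul]
    exact mul_le_mul_of_nonneg_right (hM z) (norm_nonneg _)
  have hdψ : Continuous fun z => fderiv ℝ ψ z v :=
    (hψ.continuous_fderiv (by simp)).clm_apply continuous_const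
  have t1 := tendsto_integral_mollify_mul h0 h1 hu (hb hdψ (hc.fderiv_apply ℝ v) hw)
  have t2 := tendsto_integral_mollify_mul h0 h1 hu' (hb hψ.continuous hc hw)
  have t3 := tendsto_integral_mollify_mul h0 h1 hu (hb hψ.continuous hc hw')
  have hcm : ∀ j, ContDiff ℝ 1 (mollify μ (φ j) u) := fun j =>
    (contDiff_mollify (φ j) h.1).of_le (by simp)
  -- With the first factor mollified this is the product rule for a C¹ factor; each of the three
  -- integrals then converges by Hölder's inequality.
  have hkey : ∀ j, ∫ z, mollify μ (φ j) u z * fderiv ℝ ψ z v • w z ∂μ =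
      -(∫ z, mollify μ (φ j) u' z * ψ z • w z ∂μ + ∫ z, mollify μ (φ j) u z * ψ z • w' z ∂μ) := by
    intro j
    have h3 := (k.contDiff_mul (hcm j)).2.2 ψ hψ hc
    have i1 : Integrable (fun z => mollify μ (φ j) u' z * ψ z • w z) μ :=
      integrable_mul_of_memLp_two (memLp_mollify _ hu') (hb hψ.continuous hc hw)
    have i2 : Integrable (fun z => mollify μ (φ j) u z * ψ z • w' z) μ :=
      integrable_mul_of_memLp_two (memLp_mollify _ hu) (hb hψ.continuous hc hw')
    rw [← integral_add i1 i2]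
    simp only [fderiv_mollify (φ j) h] at h3
    simpa only [smul_add, mul_smul_comm] using h3
  have hlim := tendsto_nhds_unique t1 ((t2.add t3).neg.congr fun j => (hkey j).symm)
  rw [← integral_add (integrable_mul_of_memLp_two hu' (hb hψ.continuous hc hw))
    (integrable_mul_of_memLp_two hu (hb hψ.continuous hc hw'))] at hlim
  simpa only [smul_add, mul_smul_comm] using hlim

/-- Weak derivatives in different directions commute. -/
theorem HasWeakLineDeriv.ae_comm [CompleteSpace G] {v w : E} {u a b a' b' : E → G}
    (ha : HasWeakLineDeriv μ v u a) (ha' : HasWeakLineDeriv μ w a a')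
    (hb : HasWeakLineDeriv μ w u b) (hb' : HasWeakLineDeriv μ v b b') : a' =ᵐ[μ] b' := by
  refine ae_eq_of_integral_contDiff_smul_eq ha'.2.1 hb'.2.1 fun ψ hψ hc => ?_
  have hd : ∀ v, ContDiff ℝ ∞ fun z => fderiv ℝ ψ z v := fun v =>
    (hψ.fderiv_right (by simp)).clm_apply contDiff_const
  have hdd : ∀ v w z, fderiv ℝ (fun z => fderiv ℝ ψ z v) z w = fderiv ℝ (fderiv ℝ ψ) z w v := by
    intro v w z
    have hdf : DifferentiableAt ℝ (fderiv ℝ ψ) z :=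
      (hψ.fderiv_right (m := ∞) (by simp)).differentiable (by simp) z
    rw [fderiv_clm_apply hdf (by fun_prop)]
    simp
  -- Testing against ∂_wψ and ∂_vψ moves both derivatives onto ψ, where they commute.
  have e1 := ha.2.2 _ (hd w) (hc.fderiv_apply ℝ w)
  have e2 := hb.2.2 _ (hd v) (hc.fderiv_apply ℝ v)
  have hs : ∀ z, fderiv ℝ (fderiv ℝ ψ) z v w = fderiv ℝ (fderiv ℝ ψ) z w v := fun z =>
    ((contDiff_infty.1 hψ 2).contDiffAt.isSymmSndFDerivAt (by simp)) v w
  simp only [hdd] at e1 e2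
  simp only [hs] at e1
  have e3 := ha'.2.2 ψ hψ hc
  have e4 := hb'.2.2 ψ hψ hc
  rw [e1] at e2
  rw [e3, e4, neg_neg, neg_neg] at e2
  exact e2

/-- Weak differentiation is local: it suffices to test with functions supported off `C`, and there
`u` vanishes. -/
theorem HasWeakLineDeriv.ae_eq_zero_of_isClosed [CompleteSpace G] {v : E} {u u' : E → G}
    (h : HasWeakLineDeriv μ v u u') {C : Set E} (hC : IsClosed C)
    (hu : ∀ᵐ z ∂μ, z ∉ C → u z = 0) : ∀ᵐ z ∂μ, z ∉ C → u' z = 0 := by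
  refine IsOpen.ae_eq_zero_of_integral_contDiff_smul_eq_zero hC.isOpen_compl
    (h.2.1.locallyIntegrableOn _) fun ψ hψ hc hs => ?_
  rw [← neg_eq_zero, ← h.2.2 ψ hψ hc]
  refine integral_eq_zero_of_ae (hu.mono fun z hz => ?_)
  by_cases hzC : z ∈ C
  · have : z ∉ tsupport (fderiv ℝ ψ) := fun h' => (hs (tsupport_fderiv_subset ℝ h')) hzC
    simp [image_eq_zero_of_notMem_tsupport this]
  · simp [hz hzC]

/-- Smooth cutoff functions converging to `1`, with derivatives converging to `0`. -/
theorem exists_cutoff_seq (E : Type*) [NormedAddCommGroup E] [NormedSpace ℝ E]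
    [FiniteDimensional ℝ E] : ∃ ψ : ℕ → E → ℝ, (∀ k, ContDiff ℝ ∞ (ψ k)) ∧
      (∀ k, HasCompactSupport (ψ k)) ∧ (∀ k x, ‖ψ k x‖ ≤ 1) ∧
      (∀ x, Tendsto (fun k => ψ k x) atTop (𝓝 1)) ∧
      ∃ C, ∀ k x, ‖fderiv ℝ (ψ k) x‖ ≤ C / ((k : ℝ) + 1) := by
  let f : ContDiffBump (0 : E) := ⟨1, 2, by norm_num, by norm_num⟩
  have hf : ContDiff ℝ ∞ f := f.contDiff
  obtain ⟨C, hC⟩ := (f.hasCompactSupport.fderiv ℝ).exists_bound_of_continuous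
    (hf.continuous_fderiv (by simp))
  have hk : ∀ k : ℕ, (0 : ℝ) < ((k : ℝ) + 1)⁻¹ := fun k => by positivity
  refine ⟨fun k x => f (((k : ℝ) + 1)⁻¹ • x), fun k => hf.comp (contDiff_const_smul _), fun k =>
    f.hasCompactSupport.comp_smul (hk k).ne', fun k x => ?_, fun x => ?_, C, fun k x => ?_⟩
  · rw [Real.norm_of_nonneg f.nonneg]
    exact f.le_one
  · have h1 : Tendsto (fun k : ℕ => f (((k : ℝ) + 1)⁻¹ • x)) atTop (𝓝 (f ((0 : ℝ) • x))) := by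
      refine (f.continuous.tendsto _).comp (Tendsto.smul_const ?_ x)
      simpa using tendsto_one_div_add_atTop_nhds_zero_nat (𝕜 := ℝ)
    rwa [zero_smul, f.one_of_mem_closedBall (by simp [f])] at h1
  · have h1 := ((hf.differentiable (by simp) (((k : ℝ) + 1)⁻¹ • x)).hasFDerivAt.comp x
      ((hasFDerivAt_id x).const_smul ((k : ℝ) + 1)⁻¹)).fderiv
    change ‖fderiv ℝ (f ∘ HSMul.hSMul ((k : ℝ) + 1)⁻¹) x‖ ≤ _
    rw [h1, ContinuousLinearMap.comp_smul, ContinuousLinearMap.comp_id, norm_smul,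
      Real.norm_of_nonneg (hk k).le, div_eq_inv_mul]
    exact mul_le_mul_of_nonneg_left (hC _) (hk k).le

/-- The integral of a weak derivative vanishes. -/
theorem HasWeakLineDeriv.integral_eq_zero {v : E} {u u' : E → ℂ} (h : HasWeakLineDeriv μ v u u')
    (hu : Integrable u μ) (hu' : Integrable u' μ) : ∫ z, u' z ∂μ = 0 := by
  obtain ⟨ψ, hψ, hc, hb, h1, C, hC⟩ := exists_cutoff_seq E
  have t1 : Tendsto (fun k => ∫ z, ψ k z • u' z ∂μ) atTop (𝓝 (∫ z, u' z ∂μ)) := by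
    refine tendsto_integral_of_dominated_convergence (fun z => ‖u' z‖) ?_ hu'.norm ?_ ?_
    · exact fun k => (hψ k).continuous.aestronglyMeasurable.smul hu'.1
    · refine fun k => Eventually.of_forall fun z => ?_
      rw [norm_smul]
      exact mul_le_of_le_one_left (norm_nonneg _) (hb k z)
    · exact Eventually.of_forall fun z => by simpa using (h1 z).smul_const (u' z)
  have t2 : Tendsto (fun k => ∫ z, ψ k z • u' z ∂μ) atTop (𝓝 0) := by
    have h3 : Tendsto (fun k : ℕ => C / ((k : ℝ) + 1) * ‖v‖ * ∫ z, ‖u z‖ ∂μ) atTop (𝓝 0) := by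
      have := (tendsto_one_div_add_atTop_nhds_zero_nat (𝕜 := ℝ)).const_mul
        (C * ‖v‖ * ∫ z, ‖u z‖ ∂μ)
      rw [mul_zero] at this
      refine this.congr fun k => by ring
    refine squeeze_zero_norm (fun k => ?_) h3
    rw [← norm_neg, ← h.2.2 _ (hψ k) (hc k), ← integral_const_mul]
    refine norm_integral_le_of_norm_le (hu.norm.const_mul _) (Eventually.of_forall fun z => ?_)
    rw [norm_smul]
    exact mul_le_mul_of_nonneg_right (le_of_opNorm_le _ (hC k z) v) (norm_nonneg _)
  exact tendsto_nhds_unique t1 t2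

end WeakLimits

section OptimalFeedback

open Filter
open scoped Topology

variable {P U : Type*} [NormedAddCommGroup P] [NormedSpace ℝ P] [FiniteDimensional ℝ P]
  [NormedAddCommGroup U] [NormedSpace ℝ U] [FiniteDimensional ℝ U]

/-! ### Smoothness of the optimal feedback and the envelope theorem -/

/-- Definiteness gives injectivity, and `U` has the dimension of its dual. -/
theorem isInvertible_of_pos {A : U →L[ℝ] U →L[ℝ] ℝ} (hA : ∀ v, v ≠ 0 → 0 < A v v) :
    A.IsInvertible := by
  have hinj : Function.Injective A.toLinearMap := by
    rw [← LinearMap.ker_eq_bot, LinearMap.ker_eq_bot']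
    intro v hv
    by_contra h
    have h1 := hA v h
    have h2 : A v = 0 := hv
    simp [h2] at h1
  have hdim : Module.finrank ℝ U = Module.finrank ℝ (U →L[ℝ] ℝ) := by
    rw [← (LinearMap.toContinuousLinearMap (𝕜 := ℝ) (E := U) (F' := ℝ)).finrank_eq]
    exact (Subspace.dual_finrank_eq (K := ℝ) (V := U)).symm
  refine ⟨(LinearEquiv.ofInjectiveOfFinrankEq A.toLinearMap hinj hdim).toContinuousLinearEquiv, ?_⟩
  ext v w
  rfl

theorem fderiv_partial_right {G : Type*} [NormedAddCommGroup G] [NormedSpace ℝ G] {H : P × U → G}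
    {p : P} {u : U} (hH : DifferentiableAt ℝ H (p, u)) :
    fderiv ℝ (fun u => H (p, u)) u = fderiv ℝ H (p, u) ∘L .inr ℝ P U :=
  (hH.hasFDerivAt.comp u (hasFDerivAt_prodMk_right p u)).fderiv

theorem fderiv_right_eq_zero_of_min {H : P × U → ℝ} (hH : ContDiff ℝ 2 H) {w : P → U}
    (hmin : ∀ p u, H (p, w p) ≤ H (p, u)) (p : P) :
    fderiv ℝ H (p, w p) ∘L .inr ℝ P U = 0 := by
  rw [← fderiv_partial_right (hH.differentiable (by simp) _)]
  exact IsLocalMin.fderiv_eq_zero (Eventually.of_forall fun u => hmin p u)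

/-- A continuous minimizer satisfying the second order condition is continuously differentiable. -/
theorem contDiff_minimizer {H : P × U → ℝ} (hH : ContDiff ℝ 2 H) {w : P → U} (hw : Continuous w)
    (hmin : ∀ p u, H (p, w p) ≤ H (p, u))
    (hpos : ∀ p v, v ≠ 0 → 0 < fderiv ℝ (fderiv ℝ fun u => H (p, u)) (w p) v v) :
    ContDiff ℝ 1 w := by
  set K : P × U → (U →L[ℝ] ℝ) := fun q => fderiv ℝ H q ∘L .inr ℝ P U
  have hK : ContDiff ℝ 1 K :=
    (hH.fderiv_right (m := 1) (by norm_num)).clm_comp contDiff_const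
  rw [contDiff_iff_contDiffAt]
  intro p
  have hinv : (fderiv ℝ K (p, w p) ∘L .inr ℝ P U).IsInvertible := by
    refine isInvertible_of_pos fun v hv => ?_
    have h1 := hpos p v hv
    have h2 : (fderiv ℝ fun u => H (p, u)) = fun u => K (p, u) := by
      ext1 u
      exact fderiv_partial_right (hH.differentiable (by simp) _)
    rwa [h2, fderiv_partial_right (hK.differentiable (by simp) _)] at h1
  have hc : ContDiffAt ℝ 1 K (p, w p) := hK.contDiffAt
  -- Near (p, w p) the implicit function is the only solution of H_u = 0. Continuity of `w` keeps
  -- (q, w q) in that neighbourhood, so the two agree near p.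
  have hev := hc.eventually_apply_eq_iff_implicitFunction (by simp) hinv
  have ht : Tendsto (fun p => (p, w p)) (𝓝 p) (𝓝 (p, w p)) :=
    (continuous_id.prodMk hw).tendsto p
  refine (hc.contDiffAt_implicitFunction (by simp) hinv).congr_of_eventuallyEq ?_
  filter_upwards [ht.eventually hev] with q hq
  refine (hq.1 ?_).symm
  simp only [K, fderiv_right_eq_zero_of_min hH hmin]

/-- Envelope theorem: in the chain rule the derivative of `w` is multiplied by H_u, which vanishes
at the minimizer. -/
theorem fderiv_minimum {H : P × U → ℝ} (hH : ContDiff ℝ 2 H) {w : P → U} (hw : ContDiff ℝ 1 w)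
    (hmin : ∀ p u, H (p, w p) ≤ H (p, u)) (p : P) :
    HasFDerivAt (fun p => H (p, w p)) (fderiv ℝ H (p, w p) ∘L .inl ℝ P U) p := by
  have h1 := ((hH.differentiable (by simp)) (p, w p)).hasFDerivAt.comp p
    ((hasFDerivAt_id p).prodMk (hw.differentiable (by simp) p).hasFDerivAt)
  convert! h1 using 1
  ext v
  have h0 := fderiv_right_eq_zero_of_min hH hmin p
  have h2 : fderiv ℝ H (p, w p) (0, fderiv ℝ w p v) = 0 := 
    DFunLike.congr_fun h0 (fderiv ℝ w p v)
  have h3 : ((v, fderiv ℝ w p v) : P × U) = (v, 0) + (0, fderiv ℝ w p v) := by simp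
  change fderiv ℝ H (p, w p) (v, 0) = fderiv ℝ H (p, w p) (v, fderiv ℝ w p v)
  rw [h3, map_add, h2, add_zero]

/-- The minimal value is twice continuously differentiable. -/
theorem contDiff_minimum {H : P × U → ℝ} (hH : ContDiff ℝ 2 H) {w : P → U} (hw : ContDiff ℝ 1 w)
    (hmin : ∀ p u, H (p, w p) ≤ H (p, u)) : ContDiff ℝ 2 (fun p => H (p, w p)) := by
  have h1 := fderiv_minimum hH hw hmin
  -- The derivative of `w` does not occur in that of the minimum, which is therefore C¹ although `w`
  -- is only C¹.
  rw [show (2 : WithTop ℕ∞) = 1 + 1 by norm_num, contDiff_succ_iff_fderiv]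
  refine ⟨fun p => (h1 p).differentiableAt, by simp, ?_⟩
  rw [funext fun p => (h1 p).fderiv]
  exact ((hH.fderiv_right (m := 1) (by norm_num)).comp (contDiff_id.prodMk hw)).clm_comp
    contDiff_const

end OptimalFeedback

/-! ### Pontryagin's vector field is Hamiltonian. -/

section HamiltonianField

/-- The sign `1` on state and `-1` on co-state coordinates. -/
def coordSign {n : ℕ} (a : Fin n ⊕ Fin n) : ℝ := Sum.elim (fun _ => 1) (fun _ => -1) a

/-- `F` is the Hamiltonian vector field `Ω ∇h` of a twice continuously differentiable `h`. -/
def IsHamiltonianField {n : ℕ} (F : Phase n → Phase n) (h : Phase n → ℝ) : Prop :=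
  ContDiff ℝ 2 h ∧
    ∀ z a, F z a = coordSign a * fderiv ℝ h z (EuclideanSpace.single a.swap 1)

/-- The splitting of the phase space into state and co-state. -/
noncomputable def splitting (n : ℕ) :
    Phase n →L[ℝ] EuclideanSpace ℝ (Fin n) × EuclideanSpace ℝ (Fin n) :=
  LinearMap.toContinuousLinearMap
    { toFun := fun y => (statePart y, costatePart y)
      map_add' := fun _ _ => rfl
      map_smul' := fun _ _ => rfl }

theorem splitting_apply {n : ℕ} (y : Phase n) : splitting n y = (statePart y, costatePart y) := rfl

theorem splitting_single_inl {n : ℕ} (i : Fin n) :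
    splitting n (EuclideanSpace.single (Sum.inl i) 1) = (EuclideanSpace.single i 1, 0) := by
  rw [splitting_apply]
  ext j <;> simp [statePart, costatePart]

theorem splitting_single_inr {n : ℕ} (i : Fin n) :
    splitting n (EuclideanSpace.single (Sum.inr i) 1) = (0, EuclideanSpace.single i 1) := by
  rw [splitting_apply]
  ext j <;> simp [statePart, costatePart]

/-- The witness is the minimized Hamiltonian. By the envelope theorem its partial derivatives are
those of H with u frozen at u⋆: in λ they give f, because H is affine in λ, and in x they give ∇ₓH.
-/
theorem exists_isHamiltonianField {n m : ℕ}
    {f : EuclideanSpace ℝ (Fin n) → EuclideanSpace ℝ (Fin m) → EuclideanSpace ℝ (Fin n)}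
    {l : EuclideanSpace ℝ (Fin n) → EuclideanSpace ℝ (Fin m) → ℝ}
    {ustar : EuclideanSpace ℝ (Fin n) → EuclideanSpace ℝ (Fin n) → EuclideanSpace ℝ (Fin m)}
    (hf : ContDiff ℝ 2
      (fun q : EuclideanSpace ℝ (Fin n) × EuclideanSpace ℝ (Fin m) => f q.1 q.2))
    (hl : ContDiff ℝ 2
      (fun q : EuclideanSpace ℝ (Fin n) × EuclideanSpace ℝ (Fin m) => l q.1 q.2))
    (hu_min : ∀ x lam u, hamiltonian f l x (ustar x lam) lam ≤ hamiltonian f l x u lam)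
    (hu_cont : Continuous
      (fun q : EuclideanSpace ℝ (Fin n) × EuclideanSpace ℝ (Fin n) => ustar q.1 q.2))
    (hu_pos : ∀ x lam v, v ≠ 0 →
      0 < fderiv ℝ (fderiv ℝ (fun u => hamiltonian f l x u lam)) (ustar x lam) v v) :
    ∃ h, IsHamiltonianField (pontryaginField f l ustar) h := by
  set H : (EuclideanSpace ℝ (Fin n) × EuclideanSpace ℝ (Fin n)) × EuclideanSpace ℝ (Fin m) → ℝ :=
    fun q => hamiltonian f l q.1.1 q.2 q.1.2 with hHdef
  have hH : ContDiff ℝ 2 H := by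
    have hp : ContDiff ℝ 2 (fun q : (EuclideanSpace ℝ (Fin n) × EuclideanSpace ℝ (Fin n)) ×
        EuclideanSpace ℝ (Fin m) => (q.1.1, q.2)) := by fun_prop
    exact ((contDiff_snd.comp contDiff_fst).inner ℝ (hf.comp hp)).add (hl.comp hp)
  have hmin : ∀ p u, H (p, (fun p => ustar p.1 p.2) p) ≤ H (p, u) := fun p u => hu_min p.1 p.2 u
  have hw := contDiff_minimizer hH hu_cont hmin fun p v hv => hu_pos p.1 p.2 v hv
  refine ⟨fun z => H (splitting n z, ustar (splitting n z).1 (splitting n z).2),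
    (contDiff_minimum hH hw hmin).comp (splitting n).contDiff, fun z a => ?_⟩
  have hd := ((fderiv_minimum hH hw hmin (splitting n z)).comp z (splitting n).hasFDerivAt).fderiv
  change _ = _ * fderiv ℝ ((fun p => H (p, (fun p => ustar p.1 p.2) p)) ∘ splitting n) z _
  rw [hd]
  have hHd := hH.differentiable (by simp) (splitting n z, ustar (splitting n z).1 (splitting n z).2)
  have hP : HasFDerivAt (fun p => H (p, ustar (splitting n z).1 (splitting n z).2)) _
      (splitting n z) := HasFDerivAt.comp (g := H) (splitting n z) hHd.hasFDerivAt
    (hasFDerivAt_prodMk_left (splitting n z) (ustar (splitting n z).1 (splitting n z).2))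
  rcases a with i | i
  · have h1 := HasFDerivAt.comp
      (g := fun p => H (p, ustar (splitting n z).1 (splitting n z).2)) (splitting n z).2 hP
      (hasFDerivAt_prodMk_right (splitting n z).1 (splitting n z).2)
    have h2 : HasFDerivAt (fun lam => hamiltonian f l (statePart z)
        (ustar (statePart z) (costatePart z)) lam)
        (innerSL ℝ (f (statePart z) (ustar (statePart z) (costatePart z)))) (costatePart z) := by
      refine (((innerSL ℝ (f (statePart z)
        (ustar (statePart z) (costatePart z)))).hasFDerivAt).add_const
        (l (statePart z) (ustar (statePart z) (costatePart z)))).congr_of_eventuallyEq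
        (Filter.Eventually.of_forall fun lam => ?_)
      simp [hamiltonian, real_inner_comm]
    have h3 := congrArg (fun L => L (EuclideanSpace.single i (1 : ℝ))) (h2.unique h1)
    simp only [Sum.swap_inl, ContinuousLinearMap.comp_apply, splitting_single_inr, coordSign,
      Sum.elim_inl, one_mul]
    simp [pontryaginField, stack, EuclideanSpace.inner_single_right] at h3 ⊢
    exact h3
  · have h1 := HasFDerivAt.comp
      (g := fun p => H (p, ustar (splitting n z).1 (splitting n z).2))
      (f := fun x => (x, (splitting n z).2)) (splitting n z).1 hP
      (hasFDerivAt_prodMk_left (splitting n z).1 (splitting n z).2)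
    have h2 : fderiv ℝ (fun x => hamiltonian f l x (ustar (statePart z) (costatePart z))
      (costatePart z)) (statePart z) = _ := h1.fderiv
    have h3 := congrArg (fun L => L (EuclideanSpace.single i (1 : ℝ))) h2
    simp only [Sum.swap_inr, ContinuousLinearMap.comp_apply, splitting_single_inl, coordSign,
      Sum.elim_inr]
    simp [pontryaginField, stack] at h3 ⊢
    rw [← toDual_gradient, InnerProductSpace.toDual_apply_apply,
      EuclideanSpace.inner_single_right] at h3
    simpa using h3

end HamiltonianField

/-! ### Vanishing of ω, and the generator on Sobolev classes. -/

section Bridge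

open Filter

variable {n : ℕ}

/-- The coordinate direction `e_a` of the phase space. -/
noncomputable abbrev dir {n : ℕ} (a : Fin n ⊕ Fin n) : Phase n := EuclideanSpace.single a 1

theorem HasWeakDeriv.hasWeakLineDeriv {i : Fin n ⊕ Fin n} {Φ g : Obs n} (h : HasWeakDeriv i Φ g) :
    HasWeakLineDeriv volume (dir i) Φ g := h

theorem HasWeakLineDeriv.hasWeakDeriv_mk {i : Fin n ⊕ Fin n} {Φ : Obs n} {w : Phase n → ℂ}
    (h : HasWeakLineDeriv volume (dir i) Φ w) :
    HasWeakDeriv i Φ (AEEqFun.mk w h.2.1.aestronglyMeasurable) :=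
  h.congr EventuallyEq.rfl (AEEqFun.coeFn_mk _ _).symm

theorem HasWeakLineDeriv.weakDeriv_ae_eq {i : Fin n ⊕ Fin n} {Φ : Obs n} {w : Phase n → ℂ}
    (h : HasWeakLineDeriv volume (dir i) Φ w) : weakDeriv i Φ =ᵐ[volume] w := by
  rw [h.hasWeakDeriv_mk.weakDeriv_eq]
  exact AEEqFun.coeFn_mk _ _

theorem MemSobolev.memLp {p : ℝ≥0∞} : ∀ {k : ℕ} {Φ : Obs n}, MemSobolev k p Φ → MemLp Φ p volume
  | 0, _, h => h
  | _ + 1, _, h => h.1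

theorem MemSobolev.memSobolev_weakDeriv {p : ℝ≥0∞} {k : ℕ} {Φ : Obs n}
    (h : MemSobolev (k + 1) p Φ) (i : Fin n ⊕ Fin n) : MemSobolev k p (weakDeriv i Φ) := by
  obtain ⟨g, hg, hk⟩ := h.2 i
  rwa [hg.weakDeriv_eq]

theorem MemSobolev.hasWeakLineDeriv {p : ℝ≥0∞} {k : ℕ} {Φ : Obs n}
    (h : MemSobolev (k + 1) p Φ) (i : Fin n ⊕ Fin n) :
    HasWeakLineDeriv volume (dir i) Φ (weakDeriv i Φ) := by
  obtain ⟨g, hg, -⟩ := h.2 i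
  rw [hg.weakDeriv_eq]
  exact hg

theorem MemSobolev.memLp_weakDeriv {p : ℝ≥0∞} {k : ℕ} {Φ : Obs n}
    (h : MemSobolev (k + 1) p Φ) (i : Fin n ⊕ Fin n) : MemLp (weakDeriv i Φ) p volume :=
  (h.memSobolev_weakDeriv i).memLp

theorem MemSobolev.weakDeriv_comm {p : ℝ≥0∞} {k : ℕ} {Φ : Obs n} (h : MemSobolev (k + 2) p Φ)
    (a b : Fin n ⊕ Fin n) :
    weakDeriv a (weakDeriv b Φ) =ᵐ[volume] weakDeriv b (weakDeriv a Φ) :=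
  (h.hasWeakLineDeriv b).ae_comm ((h.memSobolev_weakDeriv b).hasWeakLineDeriv a)
    (h.hasWeakLineDeriv a) ((h.memSobolev_weakDeriv a).hasWeakLineDeriv b)

/-! ### The form `ω` -/

theorem coordSign_swap (a : Fin n ⊕ Fin n) : coordSign a.swap = -coordSign a := by
  rcases a with i | i <;> simp [coordSign]

theorem omegaIntegrand_eq_sum (φ Φ : Obs n) (z : Phase n) :
    omegaIntegrand φ Φ z =
      ∑ a, (coordSign a : ℂ) * (weakDeriv a φ z * weakDeriv a.swap Φ z) := by
  simp [omegaIntegrand, Omega, Matrix.fromBlocks_mulVec, dotProduct, coordSign, Matrix.neg_mulVec]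

theorem omegaIntegrand_swap (φ Φ : Obs n) (z : Phase n) :
    omegaIntegrand φ Φ z = -omegaIntegrand Φ φ z := by
  rw [omegaIntegrand_eq_sum, omegaIntegrand_eq_sum, ← Finset.sum_neg_distrib]
  refine Fintype.sum_equiv (Equiv.sumComm _ _) _ _ fun a => ?_
  simp only [Equiv.sumComm_apply, coordSign_swap, Sum.swap_swap]
  push_cast
  ring

theorem omega_swap (φ Φ : Obs n) : omega φ Φ = -omega Φ φ := by
  simp only [omega, ← integral_neg]
  exact integral_congr_ae (Eventually.of_forall fun z => omegaIntegrand_swap φ Φ z)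

/-- Integration by parts, together with the symmetry of second derivatives, shows that `ω` vanishes
on `W_{2,2} × W_{1,2}`. -/
theorem omega_eq_zero {φ Φ : Obs n} (hφ : MemSobolev 2 2 φ) (hΦ : MemSobolev 1 2 Φ) :
    omega φ Φ = 0 := by
  have hI : ∀ a b, Integrable (fun z => weakDeriv a φ z * weakDeriv b Φ z) volume := fun a b =>
    integrable_mul_of_memLp_two (hφ.memLp_weakDeriv a) (hΦ.memLp_weakDeriv b)
  have hJ : ∀ a b, Integrable (fun z => weakDeriv b (weakDeriv a φ) z * Φ z) volume := fun a b =>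
    integrable_mul_of_memLp_two ((hφ.memSobolev_weakDeriv a).memLp_weakDeriv b) hΦ.memLp
  have hparts : ∀ a b, ∫ z, weakDeriv a φ z * weakDeriv b Φ z =
      -∫ z, weakDeriv b (weakDeriv a φ) z * Φ z := by
    intro a b
    have h1 := (((hφ.memSobolev_weakDeriv a).hasWeakLineDeriv b).mul (hΦ.hasWeakLineDeriv b)
      (hφ.memLp_weakDeriv a) ((hφ.memSobolev_weakDeriv a).memLp_weakDeriv b) hΦ.memLp
      (hΦ.memLp_weakDeriv b)).integral_eq_zero
      (integrable_mul_of_memLp_two (hφ.memLp_weakDeriv a) hΦ.memLp) ((hJ a b).add (hI a b))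
    rw [integral_add (hJ a b) (hI a b)] at h1
    exact eq_neg_of_add_eq_zero_right h1
  have hcomm : ∀ a b, ∫ z, weakDeriv b (weakDeriv a φ) z * Φ z =
      ∫ z, weakDeriv a (weakDeriv b φ) z * Φ z := fun a b =>
    integral_congr_ae ((hφ.weakDeriv_comm b a).mono fun z hz => by simp only [hz])
  have e1 : omega φ Φ =
      ∑ a, (coordSign a : ℂ) * -∫ z, weakDeriv a.swap (weakDeriv a φ) z * Φ z := by
    simp only [omega, omegaIntegrand_eq_sum]
    rw [integral_finsetSum _ fun a _ => (hI a a.swap).const_mul _]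
    simp only [integral_const_mul, hparts]
  -- Exchanging each coordinate with its conjugate flips the sign and, as second derivatives
  -- commute, preserves the integral.
  have e2 : omega φ Φ = -omega φ Φ := by
    conv_rhs => rw [e1]
    rw [e1, ← Finset.sum_neg_distrib]
    refine Fintype.sum_equiv (Equiv.sumComm _ _) _ _ fun a => ?_
    simp only [Equiv.sumComm_apply, coordSign_swap, Sum.swap_swap]
    rw [hcomm a.swap a]
    push_cast
    ring
  exact self_eq_neg.1 e2

/-! ### The Koopman generator -/

theorem component_ae_eq {F : Phase n → Phase n} {i : Fin n ⊕ Fin n}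
    (hF : Continuous fun z => F z i) : component F i =ᵐ[volume] fun z => (F z i : ℂ) := by
  have h : AEStronglyMeasurable (fun z => (F z i : ℂ)) volume :=
    (Complex.continuous_ofReal.comp hF).aestronglyMeasurable
  rw [component, dif_pos h]
  exact AEEqFun.coeFn_mk _ _

theorem _root_.MeasureTheory.AEEqFun.coeFn_finset_sum {ι α : Type*} [MeasurableSpace α]
    {ν : Measure α} (s : Finset ι) (u : ι → α →ₘ[ν] ℂ) :
    ((∑ i ∈ s, u i : α →ₘ[ν] ℂ) : α → ℂ) =ᵐ[ν] fun z => ∑ i ∈ s, u i z := by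
  classical
  induction s using Finset.induction_on with
  | empty => simpa using! AEEqFun.coeFn_zero
  | insert a s ha ih =>
    rw [Finset.sum_insert ha]
    filter_upwards [AEEqFun.coeFn_add (u a) (∑ i ∈ s, u i), ih] with z h1 h2
    rw [h1, Pi.add_apply, h2, Finset.sum_insert ha]

theorem advection_ae_eq {F : Phase n → Phase n} (hF : ∀ i, Continuous fun z => F z i)
    (Φ : W n 1 2) : advection F Φ =ᵐ[volume] fun z => ∑ i, F z i • weakDeriv i (Φ : Obs n) z := by
  refine (AEEqFun.coeFn_finset_sum Finset.univ fun i => component F i * weakDeriv i Φ.1).trans ?_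
  filter_upwards [ae_all_iff.2 fun i => AEEqFun.coeFn_mul (component F i) (weakDeriv i Φ.1),
    ae_all_iff.2 fun i => component_ae_eq (hF i)] with z h1 h2
  simp only [h1, Pi.mul_apply, h2, Complex.real_smul]

/-- The weak derivatives of `Fᵀ ∇Φ`. -/
noncomputable def advectionDeriv (F : Phase n → Phase n) (Φ : Obs n) (a : Fin n ⊕ Fin n) (z : Phase n) : ℂ :=
  ∑ b, (fderiv ℝ (fun z => F z b) z (dir a) • weakDeriv b Φ z +
    F z b • weakDeriv a (weakDeriv b Φ) z)

theorem hasWeakLineDeriv_advection {F : Phase n → Phase n} (hF : ∀ i, ContDiff ℝ 1 fun z => F z i)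
    {Φ : W n 1 2} (hΦ : MemSobolev 2 2 (Φ : Obs n)) (a : Fin n ⊕ Fin n) :
    HasWeakLineDeriv volume (dir a) (advection F Φ) (advectionDeriv F Φ a) :=
  (HasWeakLineDeriv.sum Finset.univ fun b _ =>
    ((hΦ.memSobolev_weakDeriv b).hasWeakLineDeriv a).contDiff_smul (hF b)).congr
    (advection_ae_eq (fun i => (hF i).continuous) Φ).symm EventuallyEq.rfl

theorem memLp_smul_of_isCompact {c : Phase n → ℝ} (hc : Continuous c) {C : Set (Phase n)}
    (hC : IsCompact C) {w : Phase n → ℂ} {p : ℝ≥0∞} (hw : MemLp w p volume)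
    (hz : ∀ᵐ z, z ∉ C → w z = 0) : MemLp (fun z => c z • w z) p volume := by
  obtain ⟨M, hM⟩ := hC.exists_bound_of_continuousOn hc.continuousOn
  refine MemLp.of_le_mul (c := M) hw (hc.aestronglyMeasurable.smul hw.1) (hz.mono fun z h => ?_)
  by_cases hzC : z ∈ C
  · rw [norm_smul]
    exact mul_le_mul_of_nonneg_right (hM z hzC) (norm_nonneg _)
  · simp [h hzC]

/-- `F` and its first derivatives may be unbounded on the phase space, but they are bounded on `C`,
outside of which all weak derivatives of `Φ` vanish. -/
theorem mem_generator_domain {F : Phase n → Phase n} (hF : ∀ i, ContDiff ℝ 1 fun z => F z i)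
    {Φ : W n 1 2} (hΦ : MemSobolev 2 2 (Φ : Obs n)) {C : Set (Phase n)} (hC : IsCompact C)
    (hz : ∀ᵐ z, z ∉ C → (Φ : Obs n) z = 0) : Φ ∈ (generator F).domain := by
  have hz1 : ∀ b, ∀ᵐ z, z ∉ C → weakDeriv b (Φ : Obs n) z = 0 := fun b =>
    (hΦ.hasWeakLineDeriv b).ae_eq_zero_of_isClosed hC.isClosed hz
  have hz2 : ∀ a b, ∀ᵐ z, z ∉ C → weakDeriv a (weakDeriv b (Φ : Obs n)) z = 0 := fun a b =>
    ((hΦ.memSobolev_weakDeriv b).hasWeakLineDeriv a).ae_eq_zero_of_isClosed hC.isClosed (hz1 b)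
  have h0 : MemLp (advection F Φ) 2 volume := by
    refine MemLp.ae_eq (advection_ae_eq (fun i => (hF i).continuous) Φ).symm ?_
    exact memLp_finsetSum _ fun b _ =>
      memLp_smul_of_isCompact (hF b).continuous hC (hΦ.memLp_weakDeriv b) (hz1 b)
  have h1 : ∀ a, MemLp (advectionDeriv F Φ a) 2 volume := fun a =>
    memLp_finsetSum _ fun b _ => (memLp_smul_of_isCompact
      (((hF b).continuous_fderiv (by simp)).clm_apply continuous_const) hC
      (hΦ.memLp_weakDeriv b) (hz1 b)).add (memLp_smul_of_isCompact (hF b).continuous hC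
      ((hΦ.memSobolev_weakDeriv b).memLp_weakDeriv a) (hz2 a b))
  refine ⟨hΦ, ⟨h0, fun a => ⟨_, (hasWeakLineDeriv_advection hF hΦ a).hasWeakDeriv_mk, ?_⟩⟩⟩
  exact (h1 a).ae_eq (AEEqFun.coeFn_mk _ _).symm

/-- Both sides are zero: one argument lies in W_{2,2} and the other in W_{1,2}. This needs nothing
about `F`. -/
theorem isSymplecticAdjoint_neg_generator (F : Phase n → Phase n) :
    IsSymplecticAdjoint (generator F) (-generator F) := by
  refine ⟨LinearPMap.neg_domain _, fun φ Φ => ?_⟩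
  have hφ : MemSobolev 2 2 (φ : Obs n) := φ.2.1
  have hΦ : MemSobolev 2 2 (Φ : Obs n) := Φ.2.1
  rw [omega_eq_zero hφ (generator F Φ).2, omega_swap,
    omega_eq_zero hΦ ((-generator F) φ).2, neg_zero]

end Bridge

section Flow

open Filter Metric Set
open scoped Topology NNReal

variable {n : ℕ}

/-! ### Flows of continuously differentiable vector fields -/

/-- Compactness gives a constant on the ball of radius R + 1. A point of norm at most R and one
outside that ball are at distance at least 1, so there the sup bound `M` serves as a Lipschitz
constant. -/
theorem _root_.LocallyLipschitz.lipschitzWith_of_hasCompactSupport {E : Type*}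
    [NormedAddCommGroup E] [NormedSpace ℝ E] [FiniteDimensional ℝ E] {χ : E → ℝ}
    (h : LocallyLipschitz χ) (hc : HasCompactSupport χ) : ∃ K, LipschitzWith K χ := by
  obtain ⟨R, hR0, hR⟩ := exists_radius_of_hasCompactSupport hc
  obtain ⟨M, hM⟩ := hc.exists_bound_of_continuous h.continuous
  have hM0 : 0 ≤ M := (norm_nonneg _).trans (hM 0)
  have hz : ∀ x, R < ‖x‖ → χ x = 0 := fun x hx => image_eq_zero_of_notMem_tsupport (hR x hx)
  obtain ⟨K, hK⟩ := LocallyLipschitzOn.exists_lipschitzOnWith_of_compact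
    (isCompact_closedBall (0 : E) (R + 1)) (h.locallyLipschitzOn)
  have key : ∀ x y, x ∈ closedBall (0 : E) (R + 1) → dist (χ x) (χ y) ≤ (K + M) * dist x y := by
    intro x y hx
    by_cases hy : y ∈ closedBall (0 : E) (R + 1)
    · refine (hK.dist_le_mul x hx y hy).trans ?_
      exact mul_le_mul_of_nonneg_right (by linarith) dist_nonneg
    · rw [mem_closedBall_zero_iff, not_le] at hy
      rw [hz y (by linarith), dist_zero_right]
      by_cases hx' : ‖x‖ ≤ R
      · have h1 : 1 ≤ dist x y := by
          rw [dist_comm, dist_eq_norm]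
          linarith [norm_sub_norm_le y x]
        calc ‖χ x‖ ≤ M := hM x
          _ ≤ M * dist x y := le_mul_of_one_le_right hM0 h1
          _ ≤ (K + M) * dist x y :=
            mul_le_mul_of_nonneg_right (by linarith [K.coe_nonneg]) dist_nonneg
      · rw [hz x (not_le.1 hx'), norm_zero]
        positivity
  refine ⟨K + M.toNNReal, LipschitzWith.of_dist_le_mul fun x y => ?_⟩
  rw [NNReal.coe_add, Real.coe_toNNReal M hM0]
  by_cases hx : x ∈ closedBall (0 : E) (R + 1)
  · exact key x y hx
  by_cases hy : y ∈ closedBall (0 : E) (R + 1)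
  · rw [dist_comm (χ x), dist_comm x]
    exact key y x hy
  · rw [mem_closedBall_zero_iff, not_le] at hx hy
    rw [hz x (by linarith), hz y (by linarith), dist_self]
    positivity

theorem IsFlow.continuous_time {F : Phase n → Phase n} {Γ : ℝ → Phase n → Phase n}
    (hΓ : IsFlow F Γ) (z : Phase n) : Continuous fun s => Γ s z :=
  continuous_iff_continuousAt.2 fun t => ((hΓ z).2 t).continuousAt

theorem IsFlow.neg {F : Phase n → Phase n} {Γ : ℝ → Phase n → Phase n}
    (hΓ : IsFlow F Γ) : IsFlow (-F) fun t => Γ (-t) := fun z =>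
  ⟨by simpa using (hΓ z).1, fun t => by
    simpa using! ((hΓ z).2 (-t)).scomp t (hasDerivAt_neg t)⟩

theorem exists_lipschitzOnWith_closedBall {F : Phase n → Phase n} (hF : ContDiff ℝ 1 F) (R : ℝ) :
    ∃ K, LipschitzOnWith K F (closedBall 0 R) :=
  hF.contDiffOn.exists_lipschitzOnWith (by simp) (convex_closedBall _ _) (isCompact_closedBall _ _)

/-- The flow is bounded and Lipschitz continuous near each point, uniformly on `[0, T]`. -/
theorem IsFlow.exists_bound_and_lipschitz {F : Phase n → Phase n} (hF : ContDiff ℝ 1 F)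
    {Γ : ℝ → Phase n → Phase n} (hΓ : IsFlow F Γ) (T : ℝ) (z : Phase n) :
    ∃ δ > 0, ∃ R K : ℝ, 0 ≤ K ∧ (∀ w ∈ ball z δ, ∀ s ∈ Icc 0 T, ‖Γ s w‖ ≤ R) ∧
      ∀ w ∈ ball z δ, ∀ w' ∈ ball z δ, ∀ s ∈ Icc 0 T,
        dist (Γ s w) (Γ s w') ≤ K * dist w w' := by
  obtain ⟨R, hR⟩ := isCompact_Icc (a := (0 : ℝ)) (b := T) |>.exists_bound_of_continuousOn
    (hΓ.continuous_time z).continuousOn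
  obtain ⟨K, hK⟩ := exists_lipschitzOnWith_closedBall hF (R + 1)
  have hmem : ∀ w s, s ∈ Icc 0 T → dist (Γ s w) (Γ s z) < 1 → Γ s w ∈ closedBall 0 (R + 1) := by
    intro w s hs h
    rw [mem_closedBall_zero_iff]
    rw [dist_eq_norm] at h
    linarith [hR s hs, norm_sub_norm_le (Γ s w) (Γ s z)]
  -- Grönwall's inequality, valid as long as both trajectories stay in the ball where `F` is
  -- `K`-Lipschitz.
  have hgron : ∀ w w' τ, τ ≤ T → (∀ s ∈ Ico 0 τ, Γ s w ∈ closedBall 0 (R + 1)) →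
      (∀ s ∈ Ico 0 τ, Γ s w' ∈ closedBall 0 (R + 1)) → ∀ s ∈ Icc 0 τ,
      dist (Γ s w) (Γ s w') ≤ dist w w' * Real.exp (K * T) := by
    intro w w' τ hτ hw hw' s hs
    have h1 := dist_le_of_trajectories_ODE_of_mem (v := fun _ => F) (K := K) (a := 0) (b := τ)
      (s := fun _ => closedBall 0 (R + 1)) (fun _ _ => hK) (hΓ.continuous_time w).continuousOn
      (fun t _ => ((hΓ w).2 t).hasDerivWithinAt) hw (hΓ.continuous_time w').continuousOn
      (fun t _ => ((hΓ w').2 t).hasDerivWithinAt) hw' (le_refl _) s hs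
    simp only [(hΓ w).1, (hΓ w').1] at h1
    refine h1.trans (mul_le_mul_of_nonneg_left (Real.exp_le_exp.2 ?_) dist_nonneg)
    exact mul_le_mul_of_nonneg_left (by linarith [hs.2]) K.coe_nonneg
  -- At the first time τ when the distance reaches 1, Grönwall's inequality on [0, τ] bounds it by
  -- dist w z · exp(KT), which the choice of radius makes less than 1.
  have hclose : ∀ w ∈ ball z (Real.exp (-(K * T))), ∀ s ∈ Icc 0 T,
      dist (Γ s w) (Γ s z) < 1 := by
    intro w hw
    by_contra! hcon
    have hne : (Icc 0 T ∩ {s | 1 ≤ dist (Γ s w) (Γ s z)}).Nonempty := hcon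
    have hcl : IsClosed {s | 1 ≤ dist (Γ s w) (Γ s z)} :=
      isClosed_le continuous_const ((hΓ.continuous_time w).dist (hΓ.continuous_time z))
    obtain ⟨τ, ⟨hτ, hτ1⟩, hmin⟩ := (isCompact_Icc.inter_right hcl).exists_isLeast hne
    have hlt : ∀ s ∈ Ico 0 τ, dist (Γ s w) (Γ s z) < 1 := by
      intro s hs
      by_contra! h
      exact absurd (hmin ⟨⟨hs.1, hs.2.le.trans hτ.2⟩, h⟩) (not_le.2 hs.2)
    have h1 := hgron w z τ hτ.2
      (fun s hs => hmem w s ⟨hs.1, hs.2.le.trans hτ.2⟩ (hlt s hs))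
      (fun s hs => hmem z s ⟨hs.1, hs.2.le.trans hτ.2⟩ (by simp)) τ ⟨hτ.1, le_refl _⟩
    have h2 : dist w z * Real.exp (K * T) < 1 := by
      calc dist w z * Real.exp (K * T) < Real.exp (-(K * T)) * Real.exp (K * T) :=
            mul_lt_mul_of_pos_right hw (Real.exp_pos _)
        _ = 1 := by rw [← Real.exp_add]; simp
    have h3 : 1 ≤ dist (Γ τ w) (Γ τ z) := hτ1
    linarith
  refine ⟨Real.exp (-(K * T)), Real.exp_pos _, R + 1, Real.exp (K * T), (Real.exp_pos _).le,
    fun w hw s hs => ?_, fun w hw w' hw' s hs => ?_⟩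
  · simpa using hmem w s hs (hclose w hw s hs)
  · rw [mul_comm]
    exact hgron w w' T le_rfl
      (fun s hs => hmem w s ⟨hs.1, hs.2.le⟩ (hclose w hw s ⟨hs.1, hs.2.le⟩))
      (fun s hs => hmem w' s ⟨hs.1, hs.2.le⟩ (hclose w' hw' s ⟨hs.1, hs.2.le⟩)) s hs

theorem IsFlow.continuous_space {F : Phase n → Phase n} (hF : ContDiff ℝ 1 F)
    {Γ : ℝ → Phase n → Phase n} (hΓ : IsFlow F Γ) {t : ℝ} (ht : 0 ≤ t) : Continuous (Γ t) := by
  refine continuous_iff_continuousAt.2 fun z => ?_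
  obtain ⟨δ, hδ, R, K, -, -, h⟩ := hΓ.exists_bound_and_lipschitz hF t z
  exact continuousAt_of_locally_lipschitz hδ K fun w hw =>
    h w hw z (mem_ball_self hδ) t ⟨ht, le_rfl⟩

theorem eq_of_hasDerivAt {F : Phase n → Phase n} (hF : ContDiff ℝ 1 F) {α β : ℝ → Phase n}
    (hα : ∀ t, HasDerivAt α (F (α t)) t) (hβ : ∀ t, HasDerivAt β (F (β t)) t)
    (h0 : α 0 = β 0) (t : ℝ) : α t = β t := by
  have hαc : Continuous α := continuous_iff_continuousAt.2 fun t => (hα t).continuousAt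
  have hβc : Continuous β := continuous_iff_continuousAt.2 fun t => (hβ t).continuousAt
  obtain ⟨R, hR⟩ := isCompact_Icc (a := -(|t| + 1)) (b := |t| + 1) |>.exists_bound_of_continuousOn
    hαc.continuousOn
  obtain ⟨R', hR'⟩ := isCompact_Icc (a := -(|t| + 1)) (b := |t| + 1) |>.exists_bound_of_continuousOn
    hβc.continuousOn
  obtain ⟨K, hK⟩ := exists_lipschitzOnWith_closedBall hF (max R R')
  refine ODE_solution_unique_of_mem_Ioo (v := fun _ => F) (K := K) (t₀ := 0)
    (s := fun _ => closedBall 0 (max R R')) (a := -(|t| + 1)) (b := |t| + 1) (fun _ _ => hK) ?_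
    (fun s hs => ⟨hα s, ?_⟩) (fun s hs => ⟨hβ s, ?_⟩) h0 ?_
  · constructor <;> linarith [abs_nonneg t]
  · exact mem_closedBall_zero_iff.2 ((hR s ⟨hs.1.le, hs.2.le⟩).trans (le_max_left _ _))
  · exact mem_closedBall_zero_iff.2 ((hR' s ⟨hs.1.le, hs.2.le⟩).trans (le_max_right _ _))
  · constructor <;> linarith [neg_abs_le t, le_abs_self t]

theorem IsFlow.add {F : Phase n → Phase n} (hF : ContDiff ℝ 1 F)
    {Γ : ℝ → Phase n → Phase n} (hΓ : IsFlow F Γ) (s t : ℝ) (z : Phase n) :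
    Γ t (Γ s z) = Γ (t + s) z := by
  refine eq_of_hasDerivAt hF (α := fun t => Γ t (Γ s z)) (β := fun t => Γ (t + s) z)
    (hΓ (Γ s z)).2 (fun t => ?_) ?_ t
  · exact ((hΓ z).2 (t + s)).comp_add_const t s
  · simp [(hΓ _).1]

/-- One has z = Γ₋ₛ(Γₛ z), and the reversed flow is bounded near each point of `C`, uniformly in s;
compactness makes the bound uniform on `C`. -/
theorem IsFlow.isBounded_backward {F : Phase n → Phase n} (hF : ContDiff ℝ 1 F)
    {Γ : ℝ → Phase n → Phase n} (hΓ : IsFlow F Γ) (T : ℝ) {C : Set (Phase n)} (hC : IsCompact C) :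
    ∃ R, ∀ z, ∀ s ∈ Icc 0 T, Γ s z ∈ C → ‖z‖ ≤ R := by
  have h1 : ∃ R, ∀ y ∈ C, ∀ s ∈ Icc 0 T, ‖Γ (-s) y‖ ≤ R := by
    refine hC.induction_on (p := fun C => ∃ R, ∀ y ∈ C, ∀ s ∈ Icc 0 T, ‖Γ (-s) y‖ ≤ R)
      ⟨0, by simp⟩ ?_ ?_ ?_
    · rintro A B hAB ⟨R, hR⟩
      exact ⟨R, fun y hy => hR y (hAB hy)⟩
    · rintro A B ⟨R, hR⟩ ⟨R', hR'⟩
      refine ⟨max R R', fun y hy s hs => hy.elim (fun h => ?_) fun h => ?_⟩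
      · exact (hR y h s hs).trans (le_max_left _ _)
      · exact (hR' y h s hs).trans (le_max_right _ _)
    · intro y _
      obtain ⟨δ, hδ, R, K, -, h, -⟩ := hΓ.neg.exists_bound_and_lipschitz hF.neg T y
      exact ⟨ball y δ, mem_nhdsWithin_of_mem_nhds (ball_mem_nhds y hδ), R, h⟩
  obtain ⟨R, hR⟩ := h1
  refine ⟨R, fun z s hs hz => ?_⟩
  have h2 := hR _ hz s hs
  rwa [hΓ.add hF, neg_add_cancel, (hΓ z).1] at h2

/-- The average of `ψ` along the trajectories over the time interval `[0, 1]`. -/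
noncomputable def flowAverage (Γ : ℝ → Phase n → Phase n) (ψ : Phase n → ℝ) (z : Phase n) : ℝ :=
  ∫ s in (0 : ℝ)..1, ψ (Γ s z)

/-- Only points whose trajectory meets the support of `ψ` during [0, 1] contribute, and these form a
bounded set. Local Lipschitz bounds come from those of the flow. -/
theorem IsFlow.exists_lipschitzWith_flowAverage {F : Phase n → Phase n} (hF : ContDiff ℝ 1 F)
    {Γ : ℝ → Phase n → Phase n} (hΓ : IsFlow F Γ) {ψ : Phase n → ℝ} (hψ : ContDiff ℝ ∞ ψ)
    (hc : HasCompactSupport ψ) :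
    HasCompactSupport (flowAverage Γ ψ) ∧ ∃ K, LipschitzWith K (flowAverage Γ ψ) := by
  have hcs : HasCompactSupport (flowAverage Γ ψ) := by
    obtain ⟨R, hR⟩ := hΓ.isBounded_backward hF 1 hc.isCompact
    refine HasCompactSupport.intro (isCompact_closedBall 0 R) fun z hz => ?_
    refine intervalIntegral.integral_zero_ae (Eventually.of_forall fun s hs => ?_)
    rw [uIoc_of_le zero_le_one] at hs
    refine image_eq_zero_of_notMem_tsupport fun hs' => hz ?_
    exact mem_closedBall_zero_iff.2 (hR z s ⟨hs.1.le, hs.2⟩ hs')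
  refine ⟨hcs, LocallyLipschitz.lipschitzWith_of_hasCompactSupport (fun z => ?_) hcs⟩
  obtain ⟨δ, hδ, -, K, hK, -, h⟩ := hΓ.exists_bound_and_lipschitz hF 1 z
  obtain ⟨L, hL⟩ := hψ.lipschitzWith_of_hasCompactSupport hc (by simp)
  lift K to ℝ≥0 using hK
  refine ⟨L * K, ball z δ, ball_mem_nhds z hδ, LipschitzOnWith.of_dist_le_mul ?_⟩
  intro w hw w' hw'
  have hi : ∀ w, IntervalIntegrable (fun s => ψ (Γ s w)) volume 0 1 := fun w =>
    (hψ.continuous.comp (hΓ.continuous_time w)).intervalIntegrable _ _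
  rw [dist_eq_norm, flowAverage, flowAverage, ← intervalIntegral.integral_sub (hi w) (hi w')]
  refine (intervalIntegral.norm_integral_le_of_norm_le_const (C := L * (K * dist w w'))
    fun s hs => ?_).trans (le_of_eq ?_)
  · rw [uIoc_of_le zero_le_one] at hs
    rw [← dist_eq_norm]
    exact (hL.dist_le_mul _ _).trans (mul_le_mul_of_nonneg_left
      (h w hw w' hw' s ⟨hs.1.le, hs.2⟩) L.coe_nonneg)
  · simp [mul_assoc]

/-- Along a trajectory the average is the integral of ψ(Γₛ z) over the window [r, r + 1], so the
fundamental theorem of calculus applies. -/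
theorem IsFlow.hasDerivAt_flowAverage {F : Phase n → Phase n} (hF : ContDiff ℝ 1 F)
    {Γ : ℝ → Phase n → Phase n} (hΓ : IsFlow F Γ) {ψ : Phase n → ℝ} (hψ : Continuous ψ)
    (z : Phase n) : HasDerivAt (fun r => flowAverage Γ ψ (Γ r z)) (ψ (Γ 1 z) - ψ z) 0 := by
  have hcont : Continuous fun s => ψ (Γ s z) := hψ.comp (hΓ.continuous_time z)
  have hi : ∀ a b, IntervalIntegrable (fun s => ψ (Γ s z)) volume a b := fun a b =>
    hcont.intervalIntegrable a b
  have e : (fun r => flowAverage Γ ψ (Γ r z)) =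
      fun r => (∫ s in (0 : ℝ)..(r + 1), ψ (Γ s z)) - ∫ s in (0 : ℝ)..r, ψ (Γ s z) := by
    ext r
    simp only [flowAverage, hΓ.add hF]
    rw [intervalIntegral.integral_comp_add_right (fun s => ψ (Γ s z)) r,
      intervalIntegral.integral_interval_sub_left (hi _ _) (hi _ _), zero_add, add_comm 1 r]
  have h1 : HasDerivAt (fun t => ∫ s in (0 : ℝ)..t, ψ (Γ s z)) (ψ (Γ 1 z)) (0 + 1) := by
    rw [zero_add]
    exact intervalIntegral.integral_hasDerivAt_right (hi _ _)
      (hcont.stronglyMeasurableAtFilter _ _) hcont.continuousAt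
  have h2 : HasDerivAt (fun t => ∫ s in (0 : ℝ)..t, ψ (Γ s z)) (ψ (Γ 0 z)) 0 :=
    intervalIntegral.integral_hasDerivAt_right (hi _ _)
      (hcont.stronglyMeasurableAtFilter _ _) hcont.continuousAt
  rw [(hΓ z).1] at h2
  rw [e]
  exact (h1.comp_add_const 0 1).sub h2

theorem IsFlow.fderiv_flowAverage {F : Phase n → Phase n} (hF : ContDiff ℝ 1 F)
    {Γ : ℝ → Phase n → Phase n} (hΓ : IsFlow F Γ) {ψ : Phase n → ℝ} (hψ : Continuous ψ)
    {z : Phase n} (hd : DifferentiableAt ℝ (flowAverage Γ ψ) z) :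
    fderiv ℝ (flowAverage Γ ψ) z (F z) = ψ (Γ 1 z) - ψ z := by
  have h0 : Γ 0 z = z := (hΓ z).1
  have h1 : HasFDerivAt (flowAverage Γ ψ) (fderiv ℝ (flowAverage Γ ψ) z) (Γ 0 z) := by
    rw [h0]; exact hd.hasFDerivAt
  have h2 := h1.comp_hasDerivAt 0 ((hΓ z).2 0)
  rw [h0] at h2
  exact h2.unique (hΓ.hasDerivAt_flowAverage hF hψ z)

theorem norm_flowAverage_le (Γ : ℝ → Phase n → Phase n) {ψ : Phase n → ℝ}
    (hψ : ∀ x, ‖ψ x‖ ≤ 1) (z : Phase n) : ‖flowAverage Γ ψ z‖ ≤ 1 := by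
  simpa [flowAverage] using intervalIntegral.norm_integral_le_of_norm_le_const (a := 0) (b := 1)
    (C := 1) (f := fun s => ψ (Γ s z)) fun s _ => hψ _

theorem IsFlow.tendsto_flowAverage {F : Phase n → Phase n} {Γ : ℝ → Phase n → Phase n}
    (hΓ : IsFlow F Γ) {ψ : ℕ → Phase n → ℝ} (hψ : ∀ k, Continuous (ψ k))
    (hb : ∀ k x, ‖ψ k x‖ ≤ 1) (h1 : ∀ x, Tendsto (fun k => ψ k x) atTop (𝓝 1)) (z : Phase n) :
    Tendsto (fun k => flowAverage Γ (ψ k) z) atTop (𝓝 1) := by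
  have h2 : (1 : ℝ) = ∫ _ in (0 : ℝ)..1, (1 : ℝ) := by simp
  rw [h2]
  refine intervalIntegral.tendsto_integral_filter_of_dominated_convergence (fun _ => 1)
    (Eventually.of_forall fun k => ?_) (Eventually.of_forall fun k => ?_) (by simp) ?_
  · exact ((hψ k).comp (hΓ.continuous_time z)).aestronglyMeasurable
  · exact Eventually.of_forall fun s _ => hb k _
  · exact Eventually.of_forall fun s _ => h1 _

end Flow

/-! ### The adjoint identity under a global flow. -/

section GlobalFlow

open Filter Metric Set
open scoped Topology NNReal

variable {n : ℕ}

/-! ### Derivatives of Hamiltonian vector fields -/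

theorem IsHamiltonianField.contDiff_fderiv_apply {F : Phase n → Phase n} {h : Phase n → ℝ}
    (hF : IsHamiltonianField F h) (v : Phase n) : ContDiff ℝ 1 fun z => fderiv ℝ h z v :=
  (hF.1.fderiv_right (m := 1) (by norm_num)).clm_apply contDiff_const

theorem IsHamiltonianField.contDiff_apply {F : Phase n → Phase n} {h : Phase n → ℝ}
    (hF : IsHamiltonianField F h) (a : Fin n ⊕ Fin n) : ContDiff ℝ 1 fun z => F z a := by
  simp only [hF.2]
  exact contDiff_const.mul (hF.contDiff_fderiv_apply _)

theorem IsHamiltonianField.contDiff {F : Phase n → Phase n} {h : Phase n → ℝ}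
    (hF : IsHamiltonianField F h) : ContDiff ℝ 1 F :=
  contDiff_euclidean.2 hF.contDiff_apply

/-- The Hessian of `h` in coordinates. -/
noncomputable def hessian (h : Phase n → ℝ) (z : Phase n) (a b : Fin n ⊕ Fin n) : ℝ :=
  fderiv ℝ (fderiv ℝ h) z (dir a) (dir b)

theorem hessian_comm {h : Phase n → ℝ} (hh : ContDiff ℝ 2 h) (z : Phase n) (a b : Fin n ⊕ Fin n) :
    hessian h z a b = hessian h z b a :=
  (hh.contDiffAt.isSymmSndFDerivAt (by simp)) (dir a) (dir b)

theorem IsHamiltonianField.fderiv_apply {F : Phase n → Phase n} {h : Phase n → ℝ}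
    (hF : IsHamiltonianField F h) (z : Phase n) (a b : Fin n ⊕ Fin n) :
    fderiv ℝ (fun z => F z a) z (dir b) = coordSign a * hessian h z b a.swap := by
  have hd : DifferentiableAt ℝ (fderiv ℝ h) z :=
    (hF.1.fderiv_right (m := 1) (by norm_num)).differentiable (by simp) z
  simp only [hF.2]
  rw [fderiv_const_mul ((hF.contDiff_fderiv_apply _).differentiable (by simp) z),
    fderiv_clm_apply hd (by fun_prop)]
  simp [hessian]

/-- The divergence is the trace of Ω times the Hessian, an antisymmetric matrix paired with a
symmetric one. -/
theorem IsHamiltonianField.div_eq_zero {F : Phase n → Phase n} {h : Phase n → ℝ}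
    (hF : IsHamiltonianField F h) (z : Phase n) :
    ∑ b, fderiv ℝ (fun z => F z b) z (dir b) = 0 := by
  simp only [hF.fderiv_apply]
  refine self_eq_neg.1 ?_
  rw [← Finset.sum_neg_distrib]
  refine Fintype.sum_equiv (Equiv.sumComm _ _) _ _ fun a => ?_
  simp only [Equiv.sumComm_apply, coordSign_swap, Sum.swap_swap]
  rw [hessian_comm hF.1 z a.swap a]
  ring

/-- Infinitesimal symplecticity of DF = ΩS with `S` symmetric: this cancels the terms in which a
derivative falls on `F`. -/
theorem sum_coordSign_hessian_eq_zero (S : Fin n ⊕ Fin n → Fin n ⊕ Fin n → ℂ)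
    (hS : ∀ a b, S a b = S b a) (p q : Fin n ⊕ Fin n → ℂ) :
    ∑ a, (coordSign a : ℂ) * (p a * ∑ b, (coordSign b : ℂ) * S a.swap b.swap * q b) +
      ∑ a, (coordSign a : ℂ) * ((∑ b, (coordSign b : ℂ) * S a b.swap * p b) * q a.swap) = 0 := by
  have e : ∑ a, (coordSign a : ℂ) * ((∑ b, (coordSign b : ℂ) * S a b.swap * p b) * q a.swap) =
      -∑ a, (coordSign a : ℂ) * ((∑ b, (coordSign b : ℂ) * S a.swap b.swap * p b) * q a) := by
    rw [← Finset.sum_neg_distrib]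
    refine Fintype.sum_equiv (Equiv.sumComm _ _) _ _ fun a => ?_
    simp only [Equiv.sumComm_apply, coordSign_swap, Sum.swap_swap]
    push_cast
    ring
  rw [e, add_neg_eq_zero]
  simp only [Finset.mul_sum, Finset.sum_mul]
  rw [Finset.sum_comm]
  refine Finset.sum_congr rfl fun a _ => Finset.sum_congr rfl fun b _ => ?_
  rw [hS a.swap b.swap]
  ring

/-! ### Transport along the flow -/

theorem integrable_lineDeriv_smul {χ : Phase n → ℝ} {K : ℝ≥0} (hχ : LipschitzWith K χ)
    (hc : HasCompactSupport χ) (v : Phase n) {u : Phase n → ℂ} (hu : LocallyIntegrable u volume) :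
    Integrable (fun z => lineDeriv ℝ χ z v • u z) volume := by
  have h1 : Integrable ((tsupport χ).indicator fun z => ((K * ‖v‖ : ℝ) : ℂ) * u z) volume := by
    rw [integrable_indicator_iff (isClosed_tsupport χ).measurableSet]
    exact (hu.integrableOn_isCompact hc.isCompact).const_mul _
  refine h1.mono ((aestronglyMeasurable_lineDeriv hχ.continuous volume).smul
    hu.aestronglyMeasurable) (Eventually.of_forall fun z => ?_)
  by_cases hz : z ∈ tsupport χ
  · rw [indicator_of_mem hz, norm_smul, norm_mul]
    refine mul_le_mul_of_nonneg_right ?_ (norm_nonneg _)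
    rw [Complex.norm_real]
    exact (norm_lineDeriv_le_of_lipschitz ℝ hχ).trans (le_abs_self _)
  · simp [lineDeriv_eq_zero_of_notMem_tsupport hz]

theorem sum_smul_dir (v : Phase n) : ∑ b, v b • dir b = v := by
  simpa using! (EuclideanSpace.basisFun (Fin n ⊕ Fin n) ℝ).sum_repr v

/-- Integration by parts along a divergence free vector field. -/
theorem integral_fderiv_field_smul {F : Phase n → Phase n} (hF : ∀ i, ContDiff ℝ 1 fun z => F z i)
    (hdiv : ∀ z, ∑ b, fderiv ℝ (fun z => F z b) z (dir b) = 0) {g : Phase n → ℂ}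
    {gd : Fin n ⊕ Fin n → Phase n → ℂ} (hg : ∀ b, HasWeakLineDeriv volume (dir b) g (gd b))
    {χ : Phase n → ℝ} {K : ℝ≥0} (hχ : LipschitzWith K χ) (hc : HasCompactSupport χ) :
    ∫ z, fderiv ℝ χ z (F z) • g z = -∫ z, χ z • ∑ b, F z b • gd b z := by
  have hw := fun b => (hg b).contDiff_smul (hF b)
  have e1 : ∫ z, fderiv ℝ χ z (F z) • g z =
      ∑ b, ∫ z, lineDeriv ℝ χ z (dir b) • (F z b • g z) := by
    rw [← integral_finsetSum _ fun b _ => integrable_lineDeriv_smul hχ hc (dir b) (hw b).1]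
    -- By Rademacher's theorem the line derivatives of χ assemble to a linear map almost everywhere.
    refine integral_congr_ae ((hχ.ae_differentiableAt (μ := volume)).mono fun z hz => ?_)
    simp only [hz.lineDeriv_eq_fderiv]
    conv_lhs => rw [← sum_smul_dir (F z), map_sum, Finset.sum_smul]
    refine Finset.sum_congr rfl fun b _ => ?_
    rw [map_smul, smul_eq_mul, mul_comm, mul_smul]
  rw [e1, Finset.sum_congr rfl fun b _ => (hw b).integral_lineDeriv_smul hχ hc,
    Finset.sum_neg_distrib, ← integral_finsetSum _ fun b _ =>
      (hw b).2.1.integrable_smul_left_of_hasCompactSupport hχ.continuous hc]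
  congr 1
  refine integral_congr_ae (Eventually.of_forall fun z => ?_)
  simp only [← Finset.smul_sum, Finset.sum_add_distrib, ← Finset.sum_smul, hdiv, zero_smul,
    zero_add]

/-- If the divergence free vector field `F` has a global flow, then `∫ Fᵀ ∇g = 0` for all
integrable `g` for which `Fᵀ ∇g` is integrable. -/
theorem IsFlow.integral_advection_eq_zero {F : Phase n → Phase n} (hF : ContDiff ℝ 1 F)
    (hdiv : ∀ z, ∑ b, fderiv ℝ (fun z => F z b) z (dir b) = 0)
    {Γ : ℝ → Phase n → Phase n} (hΓ : IsFlow F Γ) {g : Phase n → ℂ}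
    {gd : Fin n ⊕ Fin n → Phase n → ℂ} (hg : ∀ b, HasWeakLineDeriv volume (dir b) g (gd b))
    (hgi : Integrable g volume) (hi : Integrable (fun z => ∑ b, F z b • gd b z) volume) :
    ∫ z, ∑ b, F z b • gd b z = 0 := by
  obtain ⟨ψ, hψ, hc, hb, h1, -⟩ := exists_cutoff_seq (Phase n)
  -- Integration by parts against the flow average of ψ_k, whose derivative along `F` is ψ_k ∘ Γ₁ -
  -- ψ_k almost everywhere.
  have key : ∀ k, ∫ z, (ψ k (Γ 1 z) - ψ k z) • g z =
      -∫ z, flowAverage Γ (ψ k) z • ∑ b, F z b • gd b z := by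
    intro k
    obtain ⟨hcs, K, hK⟩ := hΓ.exists_lipschitzWith_flowAverage hF (hψ k) (hc k)
    rw [← integral_fderiv_field_smul (contDiff_euclidean.1 hF) hdiv hg hK hcs]
    refine integral_congr_ae ((hK.ae_differentiableAt (μ := volume)).mono fun z hz => ?_)
    simp only [hΓ.fderiv_flowAverage hF (hψ k).continuous hz]
  have t1 : Tendsto (fun k => ∫ z, (ψ k (Γ 1 z) - ψ k z) • g z) atTop 
      (𝓝 (∫ _ : Phase n, (0 : ℂ))) := by
    refine tendsto_integral_of_dominated_convergence (fun z => 2 * ‖g z‖) (fun k => ?_)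
      (hgi.norm.const_mul 2) (fun k => Eventually.of_forall fun z => ?_)
      (Eventually.of_forall fun z => ?_)
    · exact ((((hψ k).continuous.comp (hΓ.continuous_space hF zero_le_one)).sub
        (hψ k).continuous).aestronglyMeasurable).smul hgi.1
    · rw [norm_smul]
      refine mul_le_mul_of_nonneg_right ((norm_sub_le _ _).trans ?_) (norm_nonneg _)
      linarith [hb k (Γ 1 z), hb k z]
    · simpa using ((h1 (Γ 1 z)).sub (h1 z)).smul_const (g z)
  have t2 : Tendsto (fun k => ∫ z, flowAverage Γ (ψ k) z • ∑ b, F z b • gd b z) atTop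
      (𝓝 (∫ z, ∑ b, F z b • gd b z)) := by
    refine tendsto_integral_of_dominated_convergence (fun z => ‖∑ b, F z b • gd b z‖) (fun k => ?_)
      hi.norm (fun k => Eventually.of_forall fun z => ?_) (Eventually.of_forall fun z => ?_)
    · obtain ⟨-, K, hK⟩ := hΓ.exists_lipschitzWith_flowAverage hF (hψ k) (hc k)
      exact hK.continuous.aestronglyMeasurable.smul hi.1
    · rw [norm_smul]
      exact mul_le_of_le_one_left (norm_nonneg _) (norm_flowAverage_le Γ (hb k) z)
    · simpa using (hΓ.tendsto_flowAverage (fun k => (hψ k).continuous) hb h1 z).smul_const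
        (∑ b, F z b • gd b z)
  rw [integral_zero] at t1
  have h3 := tendsto_nhds_unique t1 (t2.neg.congr fun k => (key k).symm)
  exact neg_eq_zero.1 h3.symm

/-! ### The bracket `∇φᵀ Ω ∇Φ` and its derivative along the vector field -/

/-- The weak derivatives of `∇φᵀ Ω ∇Φ`. -/
noncomputable def bracketDeriv (φ Φ : Obs n) (b : Fin n ⊕ Fin n) (z : Phase n) : ℂ :=
  ∑ a, (coordSign a : ℂ) * (weakDeriv b (weakDeriv a φ) z * weakDeriv a.swap Φ z +
    weakDeriv a φ z * weakDeriv b (weakDeriv a.swap Φ) z)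

theorem hasWeakLineDeriv_omegaIntegrand {φ Φ : Obs n} (hφ : MemSobolev 2 2 φ)
    (hΦ : MemSobolev 2 2 Φ) (b : Fin n ⊕ Fin n) :
    HasWeakLineDeriv volume (dir b) (omegaIntegrand φ Φ) (bracketDeriv φ Φ b) := by
  have h1 := HasWeakLineDeriv.sum (μ := (volume : Measure (Phase n))) Finset.univ fun a _ =>
    (((hφ.memSobolev_weakDeriv a).hasWeakLineDeriv b).mul
      ((hΦ.memSobolev_weakDeriv a.swap).hasWeakLineDeriv b)
      (hφ.memLp_weakDeriv a) ((hφ.memSobolev_weakDeriv a).memLp_weakDeriv b)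
      (hΦ.memLp_weakDeriv a.swap) ((hΦ.memSobolev_weakDeriv a.swap).memLp_weakDeriv b)).clm
      (ContinuousLinearMap.mul ℝ ℂ (coordSign a : ℂ))
  refine h1.congr (Eventually.of_forall fun z => ?_) (Eventually.of_forall fun z => rfl)
  exact (omegaIntegrand_eq_sum φ Φ z).symm

theorem integrable_omegaIntegrand {φ Φ : Obs n} (hφ : MemSobolev 1 2 φ)
    (hΦ : MemSobolev 1 2 Φ) : Integrable (omegaIntegrand φ Φ) volume := by
  rw [funext (omegaIntegrand_eq_sum φ Φ)]
  exact integrable_finsetSum _ fun a _ => (integrable_mul_of_memLp_two (hφ.memLp_weakDeriv a)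
    (hΦ.memLp_weakDeriv a.swap)).const_mul _

theorem neg_one_smul_obs (Φ : Obs n) : (-1 : ℂ) • Φ = -Φ := by
  refine AEEqFun.ext ?_
  filter_upwards [AEEqFun.coeFn_smul (-1 : ℂ) Φ, AEEqFun.coeFn_neg Φ] with z h1 h2
  rw [h1, h2, Pi.smul_apply, Pi.neg_apply, smul_eq_mul, neg_one_mul]

theorem omegaIntegrand_neg_left {F : Phase n → Phase n} (hF : ∀ i, ContDiff ℝ 1 fun z => F z i)
    {φ : W n 1 2} (hφ : MemSobolev 2 2 (φ : Obs n)) (Φ : Obs n) :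
    omegaIntegrand (-advection F φ) Φ =ᵐ[volume] fun z => -omegaIntegrand (advection F φ) Φ z := by
  have h : ∀ a, weakDeriv a (-advection F φ) =ᵐ[volume]
      fun z => -weakDeriv a (advection F φ) z := by
    intro a
    have h1 := (hasWeakLineDeriv_advection hF hφ a).hasWeakDeriv_mk
    have h2 := h1.const_smul (-1)
    rw [neg_one_smul_obs, neg_one_smul_obs] at h2
    rw [h2.weakDeriv_eq, h1.weakDeriv_eq]
    exact AEEqFun.coeFn_neg _
  filter_upwards [ae_all_iff.2 h] with z hz
  simp only [omegaIntegrand_eq_sum, hz, neg_mul, mul_neg, Finset.sum_neg_distrib]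

/-- `L` is a derivation of the bracket. Second derivatives of φ and Φ combine to Fᵀ∇ of the bracket;
the derivatives of `F` cancel by symmetry of the Hessian of `h`. -/
theorem IsHamiltonianField.omegaIntegrand_advection_add {F : Phase n → Phase n}
    {h : Phase n → ℝ} (hF : IsHamiltonianField F h) {φ Φ : W n 1 2}
    (hφ : MemSobolev 2 2 (φ : Obs n)) (hΦ : MemSobolev 2 2 (Φ : Obs n)) :
    (fun z => omegaIntegrand (φ : Obs n) (advection F Φ) z +
      omegaIntegrand (advection F φ) (Φ : Obs n) z) =ᵐ[volume]
      fun z => ∑ b, F z b • bracketDeriv (φ : Obs n) (Φ : Obs n) b z := by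
  have hC := hF.contDiff_apply
  filter_upwards [ae_all_iff.2 fun a => (hasWeakLineDeriv_advection hC hφ a).weakDeriv_ae_eq,
    ae_all_iff.2 fun a => (hasWeakLineDeriv_advection hC hΦ a).weakDeriv_ae_eq,
    ae_all_iff.2 fun a => ae_all_iff.2 fun b => hφ.weakDeriv_comm a b,
    ae_all_iff.2 fun a => ae_all_iff.2 fun b => hΦ.weakDeriv_comm a b] with z h1 h2 h3 h4
  simp only [omegaIntegrand_eq_sum, h1, h2, advectionDeriv, bracketDeriv, hF.fderiv_apply,
    Finset.sum_add_distrib, Complex.real_smul, mul_add, add_mul, Complex.ofReal_mul]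
  have key := sum_coordSign_hessian_eq_zero (fun a b => (hessian h z a b : ℂ))
    (fun a b => by rw [hessian_comm hF.1]) (fun a => weakDeriv a (φ : Obs n) z)
    (fun a => weakDeriv a (Φ : Obs n) z)
  have e1 : ∑ a, (coordSign a : ℂ) * (weakDeriv a (φ : Obs n) z *
      ∑ b, (F z b : ℂ) * weakDeriv a.swap (weakDeriv b (Φ : Obs n)) z) =
      ∑ b, (F z b : ℂ) * ∑ a, (coordSign a : ℂ) * (weakDeriv a (φ : Obs n) z *
        weakDeriv b (weakDeriv a.swap (Φ : Obs n)) z) := by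
    simp only [Finset.mul_sum]
    rw [Finset.sum_comm]
    refine Finset.sum_congr rfl fun b _ => Finset.sum_congr rfl fun a _ => ?_
    rw [h4 a.swap b]
    ring
  have e2 : ∑ a, (coordSign a : ℂ) * ((∑ b, (F z b : ℂ) * weakDeriv a (weakDeriv b (φ : Obs n)) z)
      * weakDeriv a.swap (Φ : Obs n) z) =
      ∑ b, (F z b : ℂ) * ∑ a, (coordSign a : ℂ) * (weakDeriv b (weakDeriv a (φ : Obs n)) z *
        weakDeriv a.swap (Φ : Obs n) z) := by
    simp only [Finset.mul_sum, Finset.sum_mul]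
    rw [Finset.sum_comm]
    refine Finset.sum_congr rfl fun b _ => Finset.sum_congr rfl fun a _ => ?_
    rw [h3 a b]
    ring
  rw [e1, e2]
  linear_combination key

theorem IsHamiltonianField.omega_advection {F : Phase n → Phase n} {h : Phase n → ℝ}
    (hF : IsHamiltonianField F h) {Γ : ℝ → Phase n → Phase n} (hΓ : IsFlow F Γ) {φ Φ : W n 1 2}
    (hφ : MemSobolev 2 2 (φ : Obs n)) (hΦ : MemSobolev 2 2 (Φ : Obs n))
    (h1 : Integrable (omegaIntegrand (φ : Obs n) (advection F Φ)) volume)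
    (h2 : Integrable (omegaIntegrand (-advection F φ) (Φ : Obs n)) volume) :
    omega (φ : Obs n) (advection F Φ) = omega (-advection F φ) (Φ : Obs n) := by
  have hneg := omegaIntegrand_neg_left hF.contDiff_apply hφ (Φ : Obs n)
  have h3 : Integrable (omegaIntegrand (advection F φ) (Φ : Obs n)) volume := by
    have := (h2.congr hneg).neg
    simpa [Function.comp_def] using! this
  have hsum := hF.omegaIntegrand_advection_add hφ hΦ
  have h4 := hΓ.integral_advection_eq_zero hF.contDiff hF.div_eq_zero
    (hasWeakLineDeriv_omegaIntegrand hφ hΦ) (integrable_omegaIntegrand φ.2 Φ.2)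
    ((h1.add h3).congr hsum)
  rw [← integral_congr_ae hsum, integral_add h1 h3] at h4
  rw [omega, omega, integral_congr_ae hneg, integral_neg]
  exact eq_neg_of_add_eq_zero_left h4

end GlobalFlow

end PontryaginKoopman

theorem mainTheorem7 {n m : ℕ}
    (f : EuclideanSpace ℝ (Fin n) → EuclideanSpace ℝ (Fin m) → EuclideanSpace ℝ (Fin n))
    (l : EuclideanSpace ℝ (Fin n) → EuclideanSpace ℝ (Fin m) → ℝ)
    (ustar : EuclideanSpace ℝ (Fin n) → EuclideanSpace ℝ (Fin n) → EuclideanSpace ℝ (Fin m))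
    (hf : ContDiff ℝ 2
      (fun q : EuclideanSpace ℝ (Fin n) × EuclideanSpace ℝ (Fin m) => f q.1 q.2))
    (hf_lip : ∀ u, ∃ K, LipschitzWith K (fun x => f x u))
    (hl : ContDiff ℝ 2
      (fun q : EuclideanSpace ℝ (Fin n) × EuclideanSpace ℝ (Fin m) => l q.1 q.2))
    (hu_min : ∀ x lam u, PontryaginKoopman.hamiltonian f l x (ustar x lam) lam ≤
      PontryaginKoopman.hamiltonian f l x u lam)
    (hu_cont : Continuous
      (fun q : EuclideanSpace ℝ (Fin n) × EuclideanSpace ℝ (Fin n) => ustar q.1 q.2))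
    (hu_pos : ∀ x lam v, v ≠ 0 →
      0 < fderiv ℝ (fderiv ℝ (fun u => PontryaginKoopman.hamiltonian f l x u lam))
        (ustar x lam) v v) :
    -- the operator `-L` is a symplectic adjoint of `L`
    PontryaginKoopman.IsSymplecticAdjoint
      (PontryaginKoopman.generator (PontryaginKoopman.pontryaginField f l ustar))
      (-PontryaginKoopman.generator (PontryaginKoopman.pontryaginField f l ustar)) ∧
    -- every compactly supported element of `W_{2,2}` is in the domain of `L`
    (∀ Φ : PontryaginKoopman.W n 1 2,
      (Φ : PontryaginKoopman.Obs n) ∈ PontryaginKoopman.W n 2 2 →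
      (∃ C : Set (PontryaginKoopman.Phase n), IsCompact C ∧
        ∀ᵐ z : PontryaginKoopman.Phase n, z ∉ C → (Φ : PontryaginKoopman.Obs n) z = 0) →
      Φ ∈ (PontryaginKoopman.generator
        (PontryaginKoopman.pontryaginField f l ustar)).domain) ∧
    -- for every `Φ ∈ W_{2,2}` the function `Fᵀ ∇Φ` is weakly differentiable
    (∀ Φ : PontryaginKoopman.W n 1 2,
      (Φ : PontryaginKoopman.Obs n) ∈ PontryaginKoopman.W n 2 2 →
      ∀ i, ∃ g, PontryaginKoopman.HasWeakDeriv i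
        (PontryaginKoopman.advection (PontryaginKoopman.pontryaginField f l ustar) Φ) g) ∧
    -- if the flow is global, the identity holds on all of `W_{2,2}` as soon as both sides make sense
    (∀ Γ : ℝ → PontryaginKoopman.Phase n → PontryaginKoopman.Phase n,
      PontryaginKoopman.IsFlow (PontryaginKoopman.pontryaginField f l ustar) Γ →
      ∀ φ Φ : PontryaginKoopman.W n 1 2,
        (φ : PontryaginKoopman.Obs n) ∈ PontryaginKoopman.W n 2 2 →
        (Φ : PontryaginKoopman.Obs n) ∈ PontryaginKoopman.W n 2 2 →
        Integrable (PontryaginKoopman.omegaIntegrand (φ : PontryaginKoopman.Obs n)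
          (PontryaginKoopman.advection (PontryaginKoopman.pontryaginField f l ustar) Φ))
          volume →
        Integrable (PontryaginKoopman.omegaIntegrand
          (-PontryaginKoopman.advection (PontryaginKoopman.pontryaginField f l ustar) φ)
          (Φ : PontryaginKoopman.Obs n)) volume →
        PontryaginKoopman.omega (φ : PontryaginKoopman.Obs n)
          (PontryaginKoopman.advection (PontryaginKoopman.pontryaginField f l ustar) Φ) =
        PontryaginKoopman.omega
          (-PontryaginKoopman.advection (PontryaginKoopman.pontryaginField f l ustar) φ)
          (Φ : PontryaginKoopman.Obs n)) := by
  obtain ⟨h, hF⟩ := PontryaginKoopman.exists_isHamiltonianField hf hl hu_min hu_cont hu_pos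
  refine ⟨PontryaginKoopman.isSymplecticAdjoint_neg_generator _, fun Φ hΦ ⟨C, hC, hz⟩ =>
    PontryaginKoopman.mem_generator_domain hF.contDiff_apply hΦ hC hz, fun Φ hΦ i =>
    ⟨_, (PontryaginKoopman.hasWeakLineDeriv_advection hF.contDiff_apply hΦ i).hasWeakDeriv_mk⟩,
    fun Γ hΓ φ Φ hφ hΦ h1 h2 => hF.omega_advection hΓ hφ hΦ h1 h2⟩
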